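/- Let $\mathcal P$ be a finite classical polar space of rank $d$ over $\mathbb F_q$, that is, the set of all totally isotropic (respectively totally singular) subspaces of a non-degenerate alternating, Hermitian or quadratic form on a finite-dimensional $\mathbb F_q$-vector space; it is of one of the types $Q^+(2d-1,q)$, $H(2d-1,q)$, $Q(2d,q)$, $W(2d-1,q)$, $H(2d,q)$, $Q^-(2d+1,q)$ ($q$ a square in the Hermitian cases), and correspondingly we put $\epsilon = 0, \tfrac12, 1, 1, \tfrac32, 2$. All dimensions are vector space dimensions. The generators of $\mathcal P$ are its maximal members; they have dimension $d$. A $(d,t)$-EKR set is a set $Y$ of generators such that $d-\dim(y_1\cap y_2)\le t$ for all $y_1,y_2\in Y$; it is maximal if it is not a proper subset of another $(d,t)$-EKR set of $\mathcal P$. Let $\binom{n}{k}_q=\prod_{i=1}^{k}\frac{q^{n-i+1}-1}{q^i-1}$ if $0\le k\le n$, and $\binom{n}{k}_q=0$ for all other integers $n,k$. Let $c_{m,t}$ be the maximum size of an $(m,t)$-EKR set of a polar space of rank $m$ over $\mathbb F_q$ of the same type as $\mathcal P$. For integers $x,y,z,z_1,z_2$ let $\psi_3(d,x,y,z,z_1,z_2)$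 be the number of $z$-dimensional subspaces of $\mathbb F_q^d$ that meet a fixed $x$-dimensional subspace $X$ in a subspace of dimension $z_2$ and a fixed $y$-dimensional subspace $Y\subseteq X$ in a subspace of dimension $z_1$, if $0\le y\le x\le d$, and $0$ otherwise. Let $t\ge 0$ be an even integer with $d\ge 2t$, and put $$\psi^{\mathrm{even}}=\sum_{i=1}^{t/2-1}\psi_3\bigl(d,\;d-\tfrac32t,\;d-2t+1,\;d-\tfrac t2,\;d-\tfrac52t+1+i,\;d-2t\bigr),$$ $$b_1=\binom{d-\frac32t}{\frac t2-1}_q\,c_{2t-1,t},\qquad b_2=q^{\epsilon\frac t2+\binom{t/2}{2}}\,\psi^{\mathrm{even}},$$ where $b_1=0$ if $t=0$. If $Y$ is a maximal $(d,t)$-EKR set of $\mathcal P$ with $|Y|>b_1+b_2$, then there is a generator $U$ of $\mathcal P$ such that $Y$ is the set of all generators $W$ of $\mathcal P$ with $\dim(W\cap U)\ge d-\frac t2$. -/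

import Mathlib

noncomputable section

namespace PolarEKR

open Module

/-- The six families of finite classical polar spaces, in the order
`Q⁺(2d-1,q)`, `H(2d-1,q)`, `Q(2d,q)`, `W(2d-1,q)`, `H(2d,q)`, `Q⁻(2d+1,q)`
(the first argument is a projective dimension, `d` is the rank). -/
inductive PolarType
  | hyperbolic
  | hermitianOdd
  | parabolic
  | symplectic
  | hermitianEven
  | elliptic

/-- The parameter `ε` of a type. -/
def PolarType.eps : PolarType → ℝ
  | .hyperbolic => 0
  | .hermitianOdd => 1 / 2
  | .parabolic => 1
  | .symplectic => 1
  | .hermitianEven => 3 / 2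
  | .elliptic => 2

/-- The vector space dimension of the space carrying a polar space of the given type and rank `d`. -/
def PolarType.ambientDim : PolarType → ℕ → ℕ
  | .hyperbolic, d => 2 * d
  | .hermitianOdd, d => 2 * d
  | .parabolic, d => 2 * d + 1
  | .symplectic, d => 2 * d
  | .hermitianEven, d => 2 * d + 1
  | .elliptic, d => 2 * d + 2

section Spaces

variable {F V : Type*} [Field F] [AddCommGroup V] [Module F V]

/-- `S` is the set of totally singular subspaces of a nondegenerate quadratic form. -/
def IsQuadric (S : Set (Submodule F V)) : Prop :=
  ∃ Q : QuadraticForm F V, Q.Nondegenerate ∧ S = {W | ∀ w ∈ W, Q w = 0}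

/-- `S` is the set of totally isotropic subspaces of a nondegenerate alternating form. -/
def IsSymplectic (S : Set (Submodule F V)) : Prop :=
  ∃ B : V →ₗ[F] V →ₗ[F] F, B.IsAlt ∧ B.Nondegenerate ∧
    S = {W | ∀ v ∈ W, ∀ w ∈ W, B v w = 0}

/-- `S` is the set of totally isotropic subspaces of a nondegenerate Hermitian form with respect
to an automorphism `σ` of order two of the field (over a field with `r ^ 2` elements, this is
`x ↦ x ^ r`). -/
def IsHermitian (S : Set (Submodule F V)) : Prop :=
  ∃ (σ : F →+* F) (B : V →ₛₗ[σ] V →ₗ[F] F),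
    σ ≠ RingHom.id F ∧ (∀ a, σ (σ a) = a) ∧ B.IsSymm ∧ B.Nondegenerate ∧
    S = {W | ∀ v ∈ W, ∀ w ∈ W, B v w = 0}

/-- `S` is the set of totally isotropic (singular) subspaces of a form of the kind that belongs
to the type. -/
def PolarType.IsFormSpace : PolarType → Set (Submodule F V) → Prop
  | .hyperbolic, S => IsQuadric S
  | .hermitianOdd, S => IsHermitian S
  | .parabolic, S => IsQuadric S
  | .symplectic, S => IsSymplectic S
  | .hermitianEven, S => IsHermitian S
  | .elliptic, S => IsQuadric S

/-- `S`, as a set of subspaces of `V` ordered by inclusion, is a classical polar space of type `e`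
and rank `d`: it comes from a form of the right kind, the largest dimension of a member of `S`
is `d`, and `V` has the dimension that belongs to the type `e` and the rank `d`. -/
structure IsPolarSpace (e : PolarType) (d : ℕ) (S : Set (Submodule F V)) : Prop where
  form : e.IsFormSpace S
  rank : IsGreatest ((fun W : Submodule F V => finrank F W) '' S) d
  dim : finrank F V = e.ambientDim d

/-- The generators of a polar space are its members that are maximal under inclusion. -/
def IsGenerator (S : Set (Submodule F V)) (W : Submodule F V) : Prop :=
  Maximal (fun W' => W' ∈ S) W

/-- A `(d,t)`-EKR set of a polar space `S` of rank `d`: a set of generators any two of which meet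
in a subspace of codimension at most `t`. -/
def IsEKR (S : Set (Submodule F V)) (d t : ℕ) (Y : Set (Submodule F V)) : Prop :=
  (∀ W ∈ Y, IsGenerator S W) ∧
    ∀ y₁ ∈ Y, ∀ y₂ ∈ Y, (d : ℤ) - finrank F (y₁ ⊓ y₂ : Submodule F V) ≤ t

/-- A `(d,t)`-EKR set that is not properly contained in another `(d,t)`-EKR set. -/
def IsMaximalEKR (S : Set (Submodule F V)) (d t : ℕ) (Y : Set (Submodule F V)) : Prop :=
  Maximal (IsEKR S d t) Y

end Spaces

/-- `c_{m,t}`: the maximum size of an `(m,t)`-EKR set of generators of a polar space of type `e`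
and rank `m` over the finite field `F`. (Each such polar space is, up to isomorphism, a set of
subspaces of the coordinate space of the right dimension.) -/
def maxEKR (F : Type*) [Field F] (e : PolarType) (m t : ℕ) : ℕ :=
  sSup {n | ∃ S Y : Set (Submodule F (Fin (e.ambientDim m) → F)),
    IsPolarSpace e m S ∧ IsEKR S m t Y ∧ n = Y.ncard}

/-- The Gaussian coefficient, which is `0` unless `0 ≤ k ≤ n`. -/
def gauss (q : ℕ) (n k : ℤ) : ℝ :=
  if 0 ≤ k ∧ k ≤ n then
    ∏ i ∈ Finset.Icc (1 : ℤ) k, ((q : ℝ) ^ (n - i + 1) - 1) / ((q : ℝ) ^ i - 1)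
  else 0

/-- The subspace of `F ^ d` of all vectors supported on the first `x` coordinates; its dimension
is `x` if `0 ≤ x ≤ d`. -/
def coordSubspace (F : Type*) [Field F] (d : ℕ) (x : ℤ) : Submodule F (Fin d → F) where
  carrier := {v | ∀ i : Fin d, x ≤ ((i : ℕ) : ℤ) → v i = 0}
  zero_mem' := fun _ _ => rfl
  add_mem' := fun {a b} ha hb i hi => by simp [ha i hi, hb i hi]
  smul_mem' := fun c a ha i hi => by simp [ha i hi]

/-- `ψ₃(d,x,y,z,z₁,z₂)`: the number of `z`-spaces in `F ^ d` that meet a fixed `x`-space `X` in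
some `z₂`-space and a fixed `y`-space `Y ⊆ X` in some `z₁`-space, if `0 ≤ y ≤ x ≤ d`, and `0`
otherwise. -/
def psi3 (F : Type*) [Field F] (d : ℕ) (x y z z₁ z₂ : ℤ) : ℕ :=
  if 0 ≤ y ∧ y ≤ x ∧ x ≤ d then
    {Z : Submodule F (Fin d → F) | (finrank F Z : ℤ) = z ∧
      (finrank F (Z ⊓ coordSubspace F d x : Submodule F (Fin d → F)) : ℤ) = z₂ ∧
      (finrank F (Z ⊓ coordSubspace F d y : Submodule F (Fin d → F)) : ℤ) = z₁}.ncard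
  else 0

/-- `ψ^even` for even `t`. -/
def psiEven (F : Type*) [Field F] (d t : ℕ) : ℕ :=
  ∑ i ∈ Finset.Icc (1 : ℤ) ((t : ℤ) / 2 - 1),
    psi3 F d ((d : ℤ) - 3 * t / 2) ((d : ℤ) - 2 * t + 1) ((d : ℤ) - t / 2)
      ((d : ℤ) - 5 * t / 2 + 1 + i) ((d : ℤ) - 2 * t)

/-- `b₁` for even `t`. For `t = 0` the first factor is `0`. -/
def b1Even (F : Type*) [Field F] (e : PolarType) (d t : ℕ) : ℝ :=
  gauss (Nat.card F) ((d : ℤ) - 3 * t / 2) ((t : ℤ) / 2 - 1) * (maxEKR F e (2 * t - 1) t : ℝ)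

/-- `b₂` for even `t`. -/
def b2Even (F : Type*) [Field F] (e : PolarType) (d t : ℕ) : ℝ :=
  (Nat.card F : ℝ) ^ (e.eps * (t / 2 : ℝ) + (((t / 2).choose 2 : ℕ) : ℝ)) * (psiEven F d t : ℝ)

end PolarEKR

end

/-!
Let `t = 2k`, so that two members of `Y` meet in dimension at least `d - 2k`. For any three
generators, the sum of the pairwise intersections is totally singular, hence of dimension at most
`d`; a dimension count shows that three members of `Y` meet in dimension at least `d - 3k`
(`IsEKR.le_finrank_inf_inf`).

If this bound is never attained, then all members of `Y` meet a suitable `(d - 3k)`-subspace `X` in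
dimension at least `d - 4k + 1`. There are `gauss (d - 3k) (k - 1)` subspaces of that dimension in
`X`, and the members of `Y` containing one of them form an EKR set in its residue, a polar space of
rank `4k - 1` of the same type; so `|Y| ≤ b₁` (`IsEKR.ncard_le_b1Even_of_triples`).

If some triple attains the bound, let `X` be its intersection and `U` the sum of its pairwise
intersections, which is a generator. By the same dimension count, a member `y` of `Y` either meets
`X` in dimension at least `d - 4k + 1`, and there are at most `b₁` of these, or it satisfies
`dim (y ∩ X) = d - 4k` and `dim (y ∩ U) = d - k`. If all members of `Y` meet `U` in dimension at
least `d - k`, maximality gives the claim. If `y₄ ∈ Y` does not, then `y₄ ∩ X` contains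
some `X'` of dimension `d - 4k + 1`, and each `y` of the second kind meets `X'` in dimension at
least `d - 5k + 2`, as otherwise `U` would be spanned by parts of `y` and `y₄`. The subspaces
`y ∩ U` with these incidences are counted by `ψ^even`, and each of them lies in at most
`q ^ (ε k + binom k 2)` generators meeting `U` in nothing more (`IsPolarSpace.ncard_inf_eq_le`),
so there are at most `b₂` such `y` (`IsMaximalEKR.exists_eq_ball_of_triple`).

The facts on polar spaces are proved for the three kinds of forms at once, by means of the common
description `FormModel`.
-/

namespace PolarEKR

open Module

/-! ### A common model of the three kinds of forms -/

section Forms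

/-- A common description of the alternating, Hermitian and quadratic forms whose totally singular
subspaces form `S`: a reflexive sesquilinear form `B` (the polar form in the quadratic case) and a
set `N` of singular vectors, such that the members of `S` are the subspaces of singular vectors on
which `B` vanishes. In characteristic two `B` may be degenerate; only singular vectors are required
to stay out of its radical. The group `E` contains the values `B x v` for which `x`, `v` and `x + v`
are singular; it is `0` for quadratic forms, the kernel of the trace for Hermitian forms, and the
whole field for alternating forms. -/
structure FormModel {F V : Type*} [Field F] [AddCommGroup V] [Module F V]
    (S : Set (Submodule F V)) where
  σ : F →+* F
  B : V →ₛₗ[σ] V →ₗ[F] F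
  N : V → Prop
  E : AddSubgroup F
  σ_surj : Function.Surjective σ
  refl : ∀ v w, B v w = 0 → B w v = 0
  smul : ∀ (a : F) v, N v → N (a • v)
  add : ∀ v w, N v → N w → B v w = 0 → N (v + w)
  mem : ∀ W, W ∈ S ↔ (∀ w ∈ W, N w) ∧ ∀ v ∈ W, ∀ w ∈ W, B v w = 0
  nondeg : ∀ v, N v → (∀ w, B w v = 0) → v = 0
  diag : ∀ x v, N x → N v → N (x + v) → B x v ∈ E

section Trace

variable {F : Type*} [Field F] [Finite F]

/-- The skew elements for an involution of a finite field are at most as many as the square root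
of the order of the field: multiplication by a fixed skew element, followed by the trace of a
multiple, embeds them into the image of the trace. -/
theorem card_skew_sq_le (σ : F →+* F) (h1 : σ ≠ RingHom.id F) (h2 : ∀ a, σ (σ a) = a)
    (E : AddSubgroup F) (hE : ∀ a, a ∈ E ↔ a + σ a = 0) :
    Nat.card E * Nat.card E ≤ Nat.card F := by
  let tr : F →+ F := (AddMonoidHom.id F) + (σ : F →+ F)
  have htr : ∀ a, tr a = a + σ a := fun a => rfl
  have hker : E = tr.ker := by
    ext a; rw [hE, AddMonoidHom.mem_ker, htr]
  obtain ⟨c, hc⟩ : ∃ c, σ c ≠ c := by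
    by_contra! h
    exact h1 (RingHom.ext h)
  obtain ⟨g, hg⟩ : ∃ g, g + σ g ≠ 0 := by
    by_contra! h
    have h11 := h 1
    have := h c
    rw [map_one] at h11
    have hc' : σ c = -c := by linear_combination this
    apply hc
    rw [hc']
    linear_combination (-c) * h11
  set s : F := c - σ c with hs
  have hs0 : s ≠ 0 := fun h => hc (by rw [hs, sub_eq_zero] at h; exact h.symm)
  have hσs : σ s = -s := by rw [hs, map_sub, h2]; ring
  have hinj : Function.Injective (fun a : E => (⟨tr (g * s * a), ⟨_, rfl⟩⟩ : tr.range)) := by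
    intro a b hab
    have hab' : tr (g * s * a) = tr (g * s * b) := congrArg Subtype.val hab
    have key : ∀ x ∈ E, tr (g * s * x) = (g + σ g) * s * x := by
      intro x hx
      rw [hE] at hx
      have : σ x = -x := by linear_combination hx
      rw [htr, map_mul, map_mul, this, hσs]; ring
    rw [key _ a.2, key _ b.2] at hab'
    exact Subtype.ext (mul_left_cancel₀ (mul_ne_zero hg hs0) hab')
  have hle := Nat.card_le_card_of_injective _ hinj
  have hcard := AddSubgroup.card_eq_card_quotient_mul_card_addSubgroup E
  rw [hcard]
  refine Nat.mul_le_mul_right _ (hle.trans (le_of_eq ?_))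
  rw [hker]
  exact (Nat.card_congr (QuotientAddGroup.quotientKerEquivRange tr).toEquiv).symm

end Trace

section Models

variable {F V : Type*} [Field F] [AddCommGroup V] [Module F V]

/-- The model of a quadratic form. -/
def quadricModel (Q : QuadraticForm F V) (hQ : Q.Nondegenerate) :
    FormModel {W : Submodule F V | ∀ w ∈ W, Q w = 0} where
  σ := RingHom.id F
  B := Q.polarBilin
  N v := Q v = 0
  E := ⊥
  σ_surj := Function.surjective_id
  refl v w h := by
    rw [QuadraticMap.polarBilin_apply_apply] at h ⊢
    rw [QuadraticMap.polar_comm, h]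
  smul a v h := by rw [QuadraticMap.map_smul, h, smul_zero]
  add v w hv hw h := by
    rw [QuadraticMap.polarBilin_apply_apply] at h
    rw [QuadraticMap.map_add Q, hv, hw, h]; simp
  mem W := by
    refine ⟨fun h => ⟨h, fun v hv w hw => ?_⟩, fun h => h.1⟩
    rw [QuadraticMap.polarBilin_apply_apply, QuadraticMap.polar, h _ hv, h _ hw,
      h _ (W.add_mem hv hw)]; simp
  nondeg v hv h := by
    have : v ∈ Q.radical := by
      refine ⟨hv, LinearMap.ext fun w => ?_⟩
      have := h w
      rw [QuadraticMap.polarBilin_apply_apply] at this ⊢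
      rw [QuadraticMap.polar_comm, this]; rfl
    rw [hQ.radical_eq_bot] at this
    simpa using this
  diag x v hx hv hxv := by
    rw [QuadraticMap.map_add Q, hx, hv] at hxv
    rw [QuadraticMap.polarBilin_apply_apply]
    simpa using hxv

/-- The model of an alternating form. -/
def symplecticModel (B : V →ₗ[F] V →ₗ[F] F) (hB : B.IsAlt) (hN : B.Nondegenerate) :
    FormModel {W : Submodule F V | ∀ v ∈ W, ∀ w ∈ W, B v w = 0} where
  σ := RingHom.id F
  B := B
  N _ := True
  E := ⊤
  σ_surj := Function.surjective_id
  refl := hB.isRefl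
  smul _ _ _ := trivial
  add _ _ _ _ _ := trivial
  mem W := by simp
  nondeg v _ h := hN.2 v h
  diag _ _ _ _ _ := AddSubgroup.mem_top _

/-- The model of a Hermitian form. -/
def hermitianModel (σ : F →+* F) (B : V →ₛₗ[σ] V →ₗ[F] F)
    (h2 : ∀ a, σ (σ a) = a) (hB : B.IsSymm) (hN : B.Nondegenerate) :
    FormModel {W : Submodule F V | ∀ v ∈ W, ∀ w ∈ W, B v w = 0} where
  σ := σ
  B := B
  N v := B v v = 0
  E := (AddMonoidHom.id F + (σ : F →+ F)).ker
  σ_surj a := ⟨σ a, h2 a⟩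
  refl := hB.isRefl
  smul a v h := by simp [h]
  add v w hv hw h := by simp [hv, hw, h, hB.isRefl v w h]
  mem W := ⟨fun h => ⟨fun w hw => h w hw w hw, h⟩, fun h => h.2⟩
  nondeg v _ h := hN.2 v h
  diag x v hx hv hxv := by
    rw [AddMonoidHom.mem_ker]
    change B x v + σ (B x v) = 0
    rw [hB.eq]
    simpa [hx, hv] using hxv

end Models

variable {F V : Type*} [Field F] [AddCommGroup V] [Module F V]

/-- The form of the model restricts to a form of the same kind along every embedding
`f : F ^ m → V` whose image contains no singular vector perpendicular to the whole image and has a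
radical no larger than that of `V`. The second condition is there for quadratic forms in
characteristic two, whose polar form may have a radical of dimension one, but no larger one. -/
def FormModel.IsHereditary {S : Set (Submodule F V)} (M : FormModel S) (e : PolarType) : Prop :=
  ∀ (m : ℕ) (f : (Fin m → F) →ₗ[F] V), Function.Injective f →
    (∀ v, M.N (f v) → (∀ w, M.B (f w) (f v) = 0) → v = 0) →
    (finrank F (LinearMap.range f ⊓ (LinearMap.range f).orthogonalBilin M.B : Submodule F V) ≤
      finrank F ((⊤ : Submodule F V).orthogonalBilin M.B)) →
    e.IsFormSpace {W | W.map f ∈ S}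

theorem isHereditary_quadricModel [FiniteDimensional F V] (Q : QuadraticForm F V)
    (hQ : Q.Nondegenerate) (e : PolarType)
    (he : ∀ (m : ℕ) (S' : Set (Submodule F (Fin m → F))), IsQuadric S' → e.IsFormSpace S') :
    (quadricModel Q hQ).IsHereditary e := by
  intro m f hf h1 h2
  apply he
  have hpol : ∀ v w, (Q.comp f).polarBilin v w = Q.polarBilin (f v) (f w) := by
    intro v w
    simp [QuadraticMap.polarBilin_apply_apply, QuadraticMap.polar, QuadraticMap.comp_apply]
  refine ⟨Q.comp f, ⟨?_, ?_⟩, ?_⟩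
  · rw [eq_bot_iff]
    rintro v ⟨hv, hv'⟩
    refine h1 v hv fun w => ?_
    have := LinearMap.congr_fun hv' w
    rw [hpol] at this
    exact (quadricModel Q hQ).refl _ _ this
  · rw [← finrank_eq_rank]
    norm_cast
    have h3 : (LinearMap.ker (Q.comp f).polarBilin).map f ≤
        LinearMap.range f ⊓ (LinearMap.range f).orthogonalBilin (quadricModel Q hQ).B := by
      rintro _ ⟨v, hv, rfl⟩
      refine ⟨⟨v, rfl⟩, ?_⟩
      rintro _ ⟨w, rfl⟩
      have := LinearMap.congr_fun hv w
      rw [hpol] at this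
      exact (quadricModel Q hQ).refl _ _ this
    have h4 := (Submodule.finrank_mono h3).trans h2
    rw [← (Submodule.equivMapOfInjective f hf _).finrank_eq] at h4
    refine h4.trans ?_
    have h5 : (⊤ : Submodule F V).orthogonalBilin (quadricModel Q hQ).B ≤
        LinearMap.ker Q.polarBilin := by
      intro v hv
      ext w
      exact (quadricModel Q hQ).refl _ _ (hv w trivial)
    refine (Submodule.finrank_mono h5).trans ?_
    have := hQ.rank_rad_polar_le
    rw [← finrank_eq_rank] at this
    exact_mod_cast this
  · ext W
    simp

theorem isHereditary_symplecticModel (B : V →ₗ[F] V →ₗ[F] F) (hB : B.IsAlt)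
    (hN : B.Nondegenerate) : (symplecticModel B hB hN).IsHereditary .symplectic := by
  intro m f hf h1 h2
  refine ⟨B.compl₁₂ f f, fun v => hB (f v), ⟨?_, ?_⟩, ?_⟩
  · exact fun v hv => h1 v trivial fun w => hB.isRefl _ _ (hv w)
  · exact fun v hv => h1 v trivial hv
  · ext W
    simp

theorem isHereditary_hermitianModel (σ : F →+* F) (B : V →ₛₗ[σ] V →ₗ[F] F)
    (h1 : σ ≠ RingHom.id F) (h2 : ∀ a, σ (σ a) = a) (hB : B.IsSymm) (hN : B.Nondegenerate)
    (e : PolarType)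
    (he : ∀ (m : ℕ) (S' : Set (Submodule F (Fin m → F))), IsHermitian S' → e.IsFormSpace S') :
    (hermitianModel σ B h2 hB hN).IsHereditary e := by
  intro m f hf h3 _
  apply he
  let B' : (Fin m → F) →ₛₗ[σ] (Fin m → F) →ₗ[F] F := (B.comp f).compl₂ f
  have hB' : B'.IsSymm := ⟨fun v w => hB.eq (f v) (f w)⟩
  refine ⟨σ, B', h1, h2, hB', ⟨?_, ?_⟩, ?_⟩
  · exact fun v hv => h3 v (hv v) fun w => hB.isRefl _ _ (hv w)
  · exact fun v hv => h3 v (hv v) hv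
  · ext W
    simp [B']

/-- Every classical polar space has a hereditary model in which the group of diagonal values has
at most `q ^ (ε - (n - 2d))` elements, `n` being the ambient dimension. -/
theorem IsPolarSpace.exists_formModel [Finite F] [FiniteDimensional F V] {e : PolarType} {d : ℕ}
    {S : Set (Submodule F V)} (hS : IsPolarSpace e d S) :
    ∃ M : FormModel S, M.IsHereditary e ∧
      (Nat.card M.E : ℝ) * (Nat.card F : ℝ) ^ (finrank F V - 2 * d) ≤ (Nat.card F : ℝ) ^ e.eps := by
  have hdim := hS.dim
  have hform := hS.form
  have hq : (0 : ℝ) < Nat.card F := by exact_mod_cast Nat.card_pos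
  have hherm : ∀ (j : ℕ) (σ : F →+* F) (h1 : σ ≠ RingHom.id F) (h2 : ∀ a, σ (σ a) = a)
      (B : V →ₛₗ[σ] V →ₗ[F] F) (hB : B.IsSymm) (hN : B.Nondegenerate),
      (Nat.card (hermitianModel σ B h2 hB hN).E : ℝ) * (Nat.card F : ℝ) ^ j ≤
        (Nat.card F : ℝ) ^ ((1 / 2 : ℝ) + j) := by
    intro j σ h1 h2 B hB hN
    rw [Real.rpow_add hq, Real.rpow_natCast]
    refine mul_le_mul_of_nonneg_right ?_ (by positivity)
    rw [← Real.sqrt_eq_rpow]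
    apply Real.le_sqrt_of_sq_le
    rw [sq]
    exact_mod_cast card_skew_sq_le σ h1 h2 (hermitianModel σ B h2 hB hN).E (fun a => by
      change _ ∈ AddMonoidHom.ker _ ↔ _
      rw [AddMonoidHom.mem_ker]; rfl)
  cases e with
  | hyperbolic =>
    obtain ⟨Q, hQ, rfl⟩ := hform
    refine ⟨quadricModel Q hQ, isHereditary_quadricModel Q hQ _ fun _ _ h => h, ?_⟩
    rw [hdim]
    simp [PolarType.ambientDim, PolarType.eps, quadricModel]
  | parabolic =>
    obtain ⟨Q, hQ, rfl⟩ := hform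
    refine ⟨quadricModel Q hQ, isHereditary_quadricModel Q hQ _ fun _ _ h => h, ?_⟩
    rw [hdim]
    simp [PolarType.ambientDim, PolarType.eps, quadricModel]
  | elliptic =>
    obtain ⟨Q, hQ, rfl⟩ := hform
    refine ⟨quadricModel Q hQ, isHereditary_quadricModel Q hQ _ fun _ _ h => h, ?_⟩
    rw [hdim]
    simp [PolarType.ambientDim, PolarType.eps, quadricModel]
  | symplectic =>
    obtain ⟨B, hB, hN, rfl⟩ := hform
    refine ⟨symplecticModel B hB hN, isHereditary_symplecticModel B hB hN, ?_⟩
    rw [hdim]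
    simp [PolarType.ambientDim, PolarType.eps, symplecticModel]
  | hermitianOdd =>
    obtain ⟨σ, B, h1, h2, hB, hN, rfl⟩ := hform
    refine ⟨hermitianModel σ B h2 hB hN,
      isHereditary_hermitianModel σ B h1 h2 hB hN _ fun _ _ h => h, ?_⟩
    refine (hherm _ σ h1 h2 B hB hN).trans_eq ?_
    rw [hdim]
    simp [PolarType.ambientDim, PolarType.eps]
  | hermitianEven =>
    obtain ⟨σ, B, h1, h2, hB, hN, rfl⟩ := hform
    refine ⟨hermitianModel σ B h2 hB hN,
      isHereditary_hermitianModel σ B h1 h2 hB hN _ fun _ _ h => h, ?_⟩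
    refine (hherm _ σ h1 h2 B hB hN).trans_eq ?_
    rw [hdim]
    norm_num [PolarType.ambientDim, PolarType.eps]

end Forms

/-! ### Perpendicular spaces and generators -/

section Perp

section Linear

variable {F V : Type*} [Field F] [AddCommGroup V] [Module F V]

theorem exists_complement_within {D W : Submodule F V} (h : D ≤ W) :
    ∃ C ≤ W, D ⊓ C = ⊥ ∧ D ⊔ C = W := by
  obtain ⟨C, hC⟩ := D.exists_isCompl
  refine ⟨C ⊓ W, inf_le_right, ?_, ?_⟩
  · rw [← inf_assoc, hC.inf_eq_bot, bot_inf_eq]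
  · rw [← sup_inf_assoc_of_le _ h, hC.sup_eq_top, top_inf_eq]

theorem exists_submodule_finrank_eq [FiniteDimensional F V] {W : Submodule F V} {m : ℕ}
    (h : m ≤ finrank F W) : ∃ T ≤ W, finrank F T = m := by
  obtain ⟨s, hs⟩ : ∃ s : Fin m → W, LinearIndependent F s :=
    ⟨fun i => finBasis F W (Fin.castLE h i),
      (finBasis F W).linearIndependent.comp _ (Fin.castLE_injective h)⟩
  refine ⟨(Submodule.span F (Set.range s)).map W.subtype, Submodule.map_subtype_le _ _, ?_⟩
  rw [Submodule.finrank_map_subtype_eq, finrank_span_eq_card hs, Fintype.card_fin]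

theorem finrank_le_finrank_inf_ker_add [FiniteDimensional F V] {m : ℕ} (T : Submodule F V)
    (ψ : V →ₗ[F] (Fin m → F)) :
    finrank F T ≤ finrank F (T ⊓ LinearMap.ker ψ : Submodule F V) + m := by
  have h1 := LinearMap.finrank_range_add_finrank_ker (ψ.domRestrict T)
  have h2 : (LinearMap.ker (ψ.domRestrict T)).map T.subtype = T ⊓ LinearMap.ker ψ := by
    ext x
    simp only [Submodule.mem_map, LinearMap.mem_ker, Submodule.mem_inf]
    constructor
    · rintro ⟨y, hy, rfl⟩
      exact ⟨y.2, hy⟩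
    · rintro ⟨hx, hx'⟩
      exact ⟨⟨x, hx⟩, hx', rfl⟩
  rw [← h2, Submodule.finrank_map_subtype_eq]
  have h3 := Submodule.finrank_le (LinearMap.range (ψ.domRestrict T))
  rw [finrank_fin_fun] at h3
  omega

end Linear

variable {F V : Type*} [Field F] [AddCommGroup V] [Module F V] {S : Set (Submodule F V)}

namespace FormModel

variable (M : FormModel S)

/-- The subspace of all vectors perpendicular to `T`. -/
def perp (T : Submodule F V) : Submodule F V := T.orthogonalBilin M.B

variable {M}

theorem mem_perp_iff {T : Submodule F V} {v : V} : v ∈ M.perp T ↔ ∀ w ∈ T, M.B v w = 0 :=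
  ⟨fun h w hw => M.refl _ _ (h w hw), fun h w hw => M.refl _ _ (h w hw)⟩

theorem perp_anti {T T' : Submodule F V} (h : T ≤ T') : M.perp T' ≤ M.perp T :=
  fun _ hv w hw => hv w (h hw)

theorem le_perp_comm {T T' : Submodule F V} : T ≤ M.perp T' ↔ T' ≤ M.perp T :=
  ⟨fun h _ hw _ hv => M.refl _ _ (h hv _ hw), fun h _ hw _ hv => M.refl _ _ (h hv _ hw)⟩

theorem perp_sup (T T' : Submodule F V) : M.perp (T ⊔ T') = M.perp T ⊓ M.perp T' := by
  refine le_antisymm (le_inf (perp_anti le_sup_left) (perp_anti le_sup_right)) ?_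
  rw [le_perp_comm]
  exact sup_le (le_perp_comm.1 inf_le_left) (le_perp_comm.1 inf_le_right)

variable (M)

include M in
theorem mem_of_le {W T : Submodule F V} (hW : W ∈ S) (h : T ≤ W) : T ∈ S := by
  rw [M.mem] at hW ⊢
  exact ⟨fun w hw => hW.1 w (h hw), fun v hv w hw => hW.2 v (h hv) w (h hw)⟩

variable {M}

theorem le_perp_self {W : Submodule F V} (hW : W ∈ S) : W ≤ M.perp W :=
  fun v hv w hw => ((M.mem W).1 hW).2 w hw v hv

theorem sup_mem {W T : Submodule F V} (hW : W ∈ S) (hT : T ∈ S) (h : T ≤ M.perp W) :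
    W ⊔ T ∈ S := by
  have hW' := (M.mem W).1 hW
  have hT' := (M.mem T).1 hT
  rw [M.mem]
  refine ⟨?_, ?_⟩
  · intro x hx
    obtain ⟨w, hw, v, hv, rfl⟩ := Submodule.mem_sup.1 hx
    exact M.add _ _ (hW'.1 w hw) (hT'.1 v hv) (h hv w hw)
  · have h1 : W ⊔ T ≤ M.perp (W ⊔ T) := by
      rw [perp_sup]
      exact sup_le (le_inf (le_perp_self hW) (le_perp_comm.1 h))
        (le_inf h (le_perp_self hT))
    exact fun v hv w hw => h1 hw v hv

theorem le_of_le_perp {U T : Submodule F V} (hU : IsGenerator S U) (hT : T ∈ S)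
    (h : T ≤ M.perp U) : T ≤ U :=
  le_sup_right.trans (hU.2 (sup_mem hU.1 hT h) le_sup_left)

variable [FiniteDimensional F V]

/-- Pairing with a basis of `C` is a linear map to `F ^ k` with kernel `C^⊥`, surjective unless `C`
meets the radical. -/
theorem exists_ker_eq_perp (M : FormModel S) (C : Submodule F V) :
    ∃ ψ : V →ₗ[F] (Fin (finrank F C) → F), LinearMap.ker ψ = M.perp C ∧
      (C ⊓ M.perp ⊤ = ⊥ → Function.Surjective ψ) := by
  let b := finBasis F C
  let ψ : V →ₗ[F] (Fin (finrank F C) → F) := LinearMap.pi fun i => M.B (b i)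
  refine ⟨ψ, ?_, ?_⟩
  · refine le_antisymm ?_ ?_
    · intro v hv w hw
      have hw' : w = ∑ i, b.repr ⟨w, hw⟩ i • (b i : V) := by
        have := congrArg Subtype.val (b.sum_repr ⟨w, hw⟩)
        rw [Submodule.coe_sum] at this
        exact this.symm
      have hv' : ∀ i, M.B (b i) v = 0 := fun i => congrFun hv i
      rw [hw']
      simp [hv']
    · intro v hv
      rw [LinearMap.mem_ker]
      funext i
      exact hv _ (b i).2
  · intro h
    rw [← LinearMap.range_eq_top]
    by_contra hne
    -- A functional vanishing on the range is a combination of basis vectors in the radical.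
    obtain ⟨c, hc0, hc⟩ := Submodule.exists_le_ker_of_lt_top _ (lt_top_iff_ne_top.2 hne)
    choose a ha using fun i => M.σ_surj (c (Pi.single i 1))
    have hx : (∑ i, a i • b i : C) = 0 := by
      have : ((∑ i, a i • b i : C) : V) ∈ C ⊓ M.perp ⊤ := by
        refine ⟨Subtype.property _, mem_perp_iff.2 fun v _ => ?_⟩
        have h0 : c (ψ v) = 0 := hc ⟨v, rfl⟩
        rw [← LinearMap.sum_single_apply _ (ψ v), map_sum] at h0
        rw [← h0]
        simp only [Submodule.coe_sum, Submodule.coe_smul, map_sum, LinearMap.sum_apply,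
          LinearMap.map_smulₛₗ, LinearMap.smul_apply, smul_eq_mul]
        refine Finset.sum_congr rfl fun i _ => ?_
        rw [ha i, show (Pi.single i (ψ v i) : Fin (finrank F C) → F) =
          ψ v i • Pi.single i 1 by rw [← Pi.single_smul, smul_eq_mul, mul_one], map_smul,
          smul_eq_mul, mul_comm]
        rfl
      rw [h] at this
      exact Subtype.ext ((Submodule.mem_bot F).1 this)
    have ha0 : ∀ i, a i = 0 := fun i => (Fintype.linearIndependent_iff.1 b.linearIndependent) a hx i
    apply hc0
    refine LinearMap.pi_ext' fun i => LinearMap.ext_ring ?_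
    simp [← ha i, ha0 i]

/-- A subspace of dimension `k` modulo vectors already perpendicular to `T` imposes at most `k`
conditions on `T`. -/
theorem finrank_add_le {T W D : Submodule F V} (hD : D ≤ W) (h : T ≤ M.perp D) :
    finrank F T + finrank F D ≤ finrank F (T ⊓ M.perp W : Submodule F V) + finrank F W := by
  obtain ⟨C, _, h1, h2⟩ := exists_complement_within hD
  obtain ⟨ψ, hψ, -⟩ := M.exists_ker_eq_perp C
  have h3 := finrank_le_finrank_inf_ker_add T ψ
  have h4 := Submodule.finrank_sup_add_finrank_inf_eq D C
  rw [h1, h2, finrank_bot] at h4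
  have h5 : T ⊓ LinearMap.ker ψ = T ⊓ M.perp W := by
    rw [hψ, ← h2, perp_sup, ← inf_assoc, inf_eq_left.2 h]
  rw [h5] at h3
  omega

theorem finrank_perp_add {T : Submodule F V} (h : T ⊓ M.perp ⊤ = ⊥) :
    finrank F (M.perp T) + finrank F T = finrank F V := by
  obtain ⟨ψ, hψ, hs⟩ := M.exists_ker_eq_perp T
  have := LinearMap.finrank_range_add_finrank_ker ψ
  rw [LinearMap.range_eq_top.2 (hs h), finrank_top, finrank_fin_fun, hψ] at this
  omega

omit [FiniteDimensional F V] in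
theorem inf_radical_eq_bot {T : Submodule F V} (hT : T ∈ S) : T ⊓ M.perp ⊤ = ⊥ := by
  rw [eq_bot_iff]
  rintro v ⟨hv, hv'⟩
  simpa using M.nondeg v (((M.mem T).1 hT).1 v hv) fun w => hv' w trivial

/-- For a totally singular `T`, the double perpendicular space exceeds `T` only by the radical. -/
theorem perp_perp_le {T : Submodule F V} (hT : T ∈ S) : M.perp (M.perp T) ≤ T ⊔ M.perp ⊤ := by
  have hle : T ⊔ M.perp ⊤ ≤ M.perp (M.perp T) :=
    sup_le (le_perp_comm.1 le_rfl) (perp_anti le_top)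
  refine (Submodule.eq_of_le_of_finrank_le hle ?_).ge
  obtain ⟨C, hC, h1, h2⟩ := exists_complement_within (perp_anti le_top : M.perp ⊤ ≤ M.perp T)
  have e1 := Submodule.finrank_sup_add_finrank_inf_eq (M.perp ⊤) C
  rw [h1, h2, finrank_bot] at e1
  have e2 := finrank_perp_add (inf_radical_eq_bot (M := M) hT)
  have e3 := finrank_perp_add (M := M) (T := C) (by rw [inf_comm]; exact h1)
  have e4 := Submodule.finrank_mono (perp_anti hC : M.perp (M.perp T) ≤ M.perp C)
  have e5 := Submodule.finrank_sup_add_finrank_inf_eq T (M.perp ⊤)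
  rw [inf_radical_eq_bot hT, finrank_bot] at e5
  omega

include M in
/-- No member of `S` exceeds a generator `U` in dimension: if `dim W > dim U`, then `W ∩ U^⊥` would
be larger than `U ∩ W` and could be used to enlarge `U`. -/
theorem finrank_le_of_isGenerator {U W : Submodule F V} (hU : IsGenerator S U) (hW : W ∈ S) :
    finrank F W ≤ finrank F U := by
  have h1 := finrank_add_le (M := M) (T := W) (W := U) (D := U ⊓ W) inf_le_left
    (le_perp_comm.1 (inf_le_right.trans (le_perp_self hW)))
  have h2 : W ⊓ M.perp U ≤ U ⊓ W :=
    le_inf (le_of_le_perp hU (M.mem_of_le hW inf_le_left) inf_le_right) inf_le_left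
  have := Submodule.finrank_mono h2
  omega

end FormModel

theorem exists_le_isGenerator [Finite V] {W : Submodule F V} (hW : W ∈ S) :
    ∃ U, IsGenerator S U ∧ W ≤ U := by
  obtain ⟨U, h1, h2⟩ := (Set.toFinite S).exists_le_maximal hW
  exact ⟨U, h2, h1⟩

section Rank

variable {e : PolarType} {d : ℕ}

theorem IsPolarSpace.finrank_le (hS : IsPolarSpace e d S) {W : Submodule F V} (hW : W ∈ S) :
    finrank F W ≤ d := hS.rank.2 ⟨W, hW, rfl⟩

theorem IsPolarSpace.finrank_eq [FiniteDimensional F V]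
    (hS : IsPolarSpace e d S) (M : FormModel S) {U : Submodule F V}
    (hU : IsGenerator S U) : finrank F U = d := by
  obtain ⟨W, hW, rfl⟩ := hS.rank.1
  exact le_antisymm (hS.finrank_le hU.1) (M.finrank_le_of_isGenerator hU hW)

theorem IsPolarSpace.isGenerator [FiniteDimensional F V]
    (hS : IsPolarSpace e d S) {U : Submodule F V} (hU : U ∈ S) (h : d ≤ finrank F U) : IsGenerator S U :=
  ⟨hU, fun _ hW hle =>
    (Submodule.eq_of_le_of_finrank_le hle ((hS.finrank_le hW).trans h)).ge⟩

end Rank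

end Perp

/-! ### Generators meeting a given generator in a prescribed subspace -/

section Opposite

/-- A component map along a subgroup `E`: together with the class modulo `E` it determines the
element. -/
theorem exists_transversal_map {F : Type*} [AddCommGroup F] (E : AddSubgroup F) :
    ∃ φ : F → E, ∀ a b, b - a ∈ E → φ a = φ b → b - a = 0 := by
  refine ⟨fun a => ⟨-a + (QuotientAddGroup.mk a : F ⧸ E).out, ?_⟩, ?_⟩
  · rw [← QuotientAddGroup.eq, QuotientAddGroup.out_eq']
  · intro a b hab h
    have h1 : (QuotientAddGroup.mk a : F ⧸ E) = QuotientAddGroup.mk b := by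
      rw [QuotientAddGroup.eq, neg_add_eq_sub]; exact hab
    have h2 := congrArg Subtype.val h
    simp only [h1, add_left_inj, neg_inj] at h2
    rw [h2, sub_self]

variable {F V : Type*} [Field F] [AddCommGroup V] [Module F V]
  {S : Set (Submodule F V)} {e : PolarType} {d : ℕ}

theorem inf_perp_of_inf_eq (M : FormModel S)
    {U Z W : Submodule F V} (hU : IsGenerator S U) (hW : IsGenerator S W) (h : W ⊓ U = Z) :
    W ⊓ M.perp U = Z := by
  rw [← h]
  refine le_antisymm (le_inf inf_le_left ?_) (inf_le_inf_left _ (FormModel.le_perp_self hU.1))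
  exact FormModel.le_of_le_perp hU (M.mem_of_le hW.1 inf_le_left) inf_le_right

theorem IsPolarSpace.sup_perp_of_inf_eq [FiniteDimensional F V]
    (hS : IsPolarSpace e d S) (M : FormModel S)
    {U Z W : Submodule F V} (hU : IsGenerator S U) (hW : IsGenerator S W) (h : W ⊓ U = Z) :
    W ⊔ M.perp U = M.perp Z := by
  have hZW : Z ≤ W := h ▸ inf_le_left
  have hZU : Z ≤ U := h ▸ inf_le_right
  refine Submodule.eq_of_le_of_finrank_le
    (sup_le ((FormModel.le_perp_self hW.1).trans (FormModel.perp_anti hZW))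
      (FormModel.perp_anti hZU)) ?_
  have h1 := Submodule.finrank_sup_add_finrank_inf_eq W (M.perp U)
  rw [inf_perp_of_inf_eq M hU hW h] at h1
  have h2 := FormModel.finrank_perp_add (FormModel.inf_radical_eq_bot (M := M) hU.1)
  have h3 := FormModel.finrank_perp_add
    (FormModel.inf_radical_eq_bot (M := M) (M.mem_of_le hU.1 hZU))
  have h4 := hS.finrank_eq M hU
  have h5 := hS.finrank_eq M hW
  omega

/-- In a generator `W` meeting `U` in `Z`, choose vectors `x i` congruent modulo `U^⊥` to a basis
`w i` of a complement of `Z` in one such generator. Then `W` is determined by the classes of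
`x i - w i` modulo `U`, the values `B (w i) (x j)` for `i < j`, and a component in `E` of the
diagonal values `B (w j) (x j)`, because the remaining values are forced by `W` being totally
singular. -/
theorem IsPolarSpace.ncard_inf_eq_le_of_formModel [Finite F] [FiniteDimensional F V]
    (hS : IsPolarSpace e d S) (M : FormModel S) {U Z : Submodule F V} (hU : IsGenerator S U) {k : ℕ}
    (hk : finrank F Z + k = d) :
    {W | IsGenerator S W ∧ W ⊓ U = Z}.ncard ≤
      Nat.card F ^ ((finrank F V - 2 * d) * k) * (Nat.card F ^ (k.choose 2) * Nat.card M.E ^ k) := by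
  have hfV : Finite V := Module.finite_of_finite F
  rcases Set.eq_empty_or_nonempty {W | IsGenerator S W ∧ W ⊓ U = Z} with h0 | ⟨W₀, hW₀, hZ₀⟩
  · rw [h0, Set.ncard_empty]; exact Nat.zero_le _
  have hZW₀ : Z ≤ W₀ := hZ₀ ▸ inf_le_left
  have hZU : Z ≤ U := hZ₀ ▸ inf_le_right
  obtain ⟨C, hC, hC1, hC2⟩ := exists_complement_within hZW₀
  have hCk : finrank F C = k := by
    have h1 := Submodule.finrank_sup_add_finrank_inf_eq Z C
    rw [hC1, hC2, finrank_bot, hS.finrank_eq M hW₀] at h1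
    omega
  let b := finBasisOfFinrankEq F C hCk
  let w : Fin k → V := fun i => b i
  have hw : ∀ i, w i ∈ W₀ := fun i => hC (b i).2
  set T := {W | IsGenerator S W ∧ W ⊓ U = Z} with hT
  have hx : ∀ W : T, ∀ i, ∃ x ∈ (W : Submodule F V), x - w i ∈ M.perp U := by
    rintro ⟨W, hW, hWZ⟩ i
    have h1 : w i ∈ W ⊔ M.perp U := by
      rw [hS.sup_perp_of_inf_eq M hU hW hWZ, ← hS.sup_perp_of_inf_eq M hU hW₀ hZ₀]
      exact Submodule.mem_sup_left (hw i)
    obtain ⟨x, hx, u, hu, hxu⟩ := Submodule.mem_sup.1 h1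
    exact ⟨x, hx, by rw [← hxu]; simpa using hu⟩
  choose x hxW hxU using hx
  obtain ⟨φ, hφ⟩ := exists_transversal_map M.E
  let U' : Submodule F (M.perp U) := U.comap (M.perp U).subtype
  let Φ : T → (Fin k → (M.perp U) ⧸ U') × (((j : Fin k) → Fin j → F) × (Fin k → M.E)) :=
    fun W => ⟨fun i => Submodule.Quotient.mk ⟨x W i - w i, hxU W i⟩,
      fun j i => M.B (w ⟨i, i.2.trans j.2⟩) (x W j), fun j => φ (M.B (w j) (x W j))⟩
  have hle : ∀ W W' : T, Φ W = Φ W' → (W' : Submodule F V) ≤ W := by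
    intro W W' h
    have hS1 := (M.mem _).1 W.2.1.1
    have hS2 := (M.mem _).1 W'.2.1.1
    have hSU := (M.mem _).1 hU.1
    set v : Fin k → V := fun i => x W' i - x W i with hv
    have hxv : ∀ i, x W' i = x W i + v i := fun i => (add_sub_cancel _ _).symm
    have hvU : ∀ i, v i ∈ U := by
      intro i
      have h1 := congrFun (congrArg Prod.fst h) i
      have h2 := (Submodule.Quotient.eq U').1 h1.symm
      have h3 : (x W' i - w i) - (x W i - w i) ∈ U := h2
      rwa [sub_sub_sub_cancel_right] at h3
    have hxw : ∀ i, ∀ u ∈ U, M.B (x W i) u = M.B (w i) u := by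
      intro i u hu
      have := FormModel.mem_perp_iff.1 (hxU W i) u hu
      rwa [map_sub, LinearMap.sub_apply, sub_eq_zero] at this
    have hlt : ∀ i j : Fin k, i < j → M.B (w i) (v j) = 0 := by
      intro i j hij
      have h1 : M.B (w i) (x W j) = M.B (w i) (x W' j) :=
        congrFun (congrFun (congrArg (fun p => p.2.1) h) j) ⟨i, hij⟩
      rw [hv, map_sub, h1, sub_self]
    have hdiag : ∀ j : Fin k, M.B (w j) (v j) = 0 := by
      intro j
      have h1 : φ (M.B (w j) (x W j)) = φ (M.B (w j) (x W' j)) :=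
        congrFun (congrArg (fun p => p.2.2) h) j
      have h2 : M.B (w j) (v j) = M.B (w j) (x W' j) - M.B (w j) (x W j) := map_sub _ _ _
      rw [h2]
      refine hφ _ _ ?_ h1
      rw [← h2, ← hxw j _ (hvU j)]
      refine M.diag _ _ (hS1.1 _ (hxW W j)) (hSU.1 _ (hvU j)) ?_
      rw [← hxv]
      exact hS2.1 _ (hxW W' j)
    have hgt : ∀ i j : Fin k, j < i → M.B (w i) (v j) = 0 := by
      intro i j hij
      have h1 := hS2.2 _ (hxW W' i) _ (hxW W' j)
      rw [hxv i, hxv j, map_add M.B, LinearMap.add_apply, map_add, map_add,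
        hS1.2 _ (hxW W i) _ (hxW W j), hSU.2 _ (hvU i) _ (hvU j)] at h1
      have h2 : M.B (v i) (x W j) = 0 :=
        M.refl _ _ ((hxw j _ (hvU i)).trans (hlt j i hij))
      rw [h2, zero_add, add_zero, add_zero] at h1
      rw [← hxw i _ (hvU j), h1]
    have hall : ∀ i j : Fin k, M.B (w i) (v j) = 0 := by
      intro i j
      rcases lt_trichotomy i j with hij | rfl | hij
      exacts [hlt i j hij, hdiag i, hgt i j hij]
    -- The differences `v j` lie in `U` and are perpendicular to `W₀`, hence lie in `Z`.
    have hCspan : C = Submodule.span F (Set.range w) := by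
      have h1 := congrArg (Submodule.map C.subtype) b.span_eq
      rw [Submodule.map_subtype_top, Submodule.map_span, ← Set.range_comp] at h1
      exact h1.symm
    have hvZ : ∀ j, v j ∈ Z := by
      intro j
      have h1 : Submodule.span F {v j} ≤ M.perp W₀ := by
        rw [← hC2, FormModel.perp_sup]
        refine le_inf ?_ ?_
        · rw [Submodule.span_singleton_le_iff_mem]
          exact FormModel.perp_anti hZU (FormModel.le_perp_self hU.1 (hvU j))
        · rw [FormModel.le_perp_comm, hCspan, Submodule.span_le]
          rintro _ ⟨i, rfl⟩
          refine FormModel.mem_perp_iff.2 fun y hy => ?_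
          obtain ⟨a, rfl⟩ := Submodule.mem_span_singleton.1 hy
          rw [map_smul, hall, smul_zero]
      have h2 := FormModel.le_of_le_perp hW₀ (M.mem_of_le hU.1
        ((Submodule.span_singleton_le_iff_mem _ _).2 (hvU j))) h1
      rw [← hZ₀]
      exact ⟨h2 (Submodule.mem_span_singleton_self _), hvU j⟩
    have hZW : Z ≤ W := W.2.2 ▸ inf_le_left
    have hZW' : Z ≤ W' := W'.2.2 ▸ inf_le_left
    have hxWW : ∀ j, x W' j ∈ (W : Submodule F V) := by
      intro j
      rw [hxv]
      exact Submodule.add_mem _ (hxW W j) (hZW (hvZ j))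
    -- Modulo `U^⊥`, every vector of `W'` is a combination of the `x i` and a vector of `Z`.
    intro y hy
    have h1 : y ∈ W₀ ⊔ M.perp U := by
      rw [hS.sup_perp_of_inf_eq M hU hW₀ hZ₀, ← hS.sup_perp_of_inf_eq M hU W'.2.1 W'.2.2]
      exact Submodule.mem_sup_left hy
    obtain ⟨y₀, hy₀, u, hu, rfl⟩ := Submodule.mem_sup.1 h1
    rw [← hC2] at hy₀
    obtain ⟨z, hz, c, hc, rfl⟩ := Submodule.mem_sup.1 hy₀
    rw [hCspan] at hc
    obtain ⟨a, rfl⟩ := (Submodule.mem_span_range_iff_exists_fun F).1 hc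
    have h2 : z + ∑ i, a i • w i + u - ∑ i, a i • x W' i ∈ Z := by
      rw [← inf_perp_of_inf_eq M hU W'.2.1 W'.2.2]
      refine ⟨Submodule.sub_mem _ hy (Submodule.sum_mem _ fun i _ =>
        Submodule.smul_mem _ _ (hxW W' i)), ?_⟩
      have h3 : z + ∑ i, a i • w i + u - ∑ i, a i • x W' i =
          z + u - ∑ i, a i • (x W' i - w i) := by
        simp only [smul_sub, Finset.sum_sub_distrib]; abel
      rw [h3]
      exact Submodule.sub_mem _ (Submodule.add_mem _ (FormModel.le_perp_self hU.1 (hZU hz)) hu)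
        (Submodule.sum_mem _ fun i _ => Submodule.smul_mem _ _ (hxU W' i))
    have h4 := Submodule.add_mem _ (hZW h2) (Submodule.sum_mem _ fun i (_ : i ∈ Finset.univ) =>
      Submodule.smul_mem _ (a i) (hxWW i))
    rwa [sub_add_cancel] at h4
  have hinj : Function.Injective Φ := fun W W' h =>
    Subtype.ext (le_antisymm (hle W' W h.symm) (hle W W' h))
  have hfin : Finite ((M.perp U) ⧸ U') := Finite.of_surjective _ U'.mkQ_surjective
  have hcard := Nat.card_le_card_of_injective Φ hinj
  have hUU : U ≤ M.perp U := FormModel.le_perp_self hU.1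
  have hq : finrank F ((M.perp U) ⧸ U') = finrank F V - 2 * d := by
    have h1 := U'.finrank_quotient_add_finrank
    have h2 : finrank F U' = finrank F U :=
      (Submodule.comapSubtypeEquivOfLe hUU).finrank_eq
    have h3 := FormModel.finrank_perp_add (FormModel.inf_radical_eq_bot (M := M) hU.1)
    have h4 := hS.finrank_eq M hU
    omega
  rw [Nat.card_prod, Nat.card_prod, Nat.card_fun, Nat.card_fun, Nat.card_pi,
    Module.natCard_eq_pow_finrank (K := F) (V := (M.perp U) ⧸ U'), hq, ← pow_mul] at hcard
  simp only [Nat.card_fun, Nat.card_fin, Finset.prod_pow_eq_pow_sum] at hcard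
  rw [Fin.sum_univ_eq_sum_range (fun i => i), Finset.sum_range_id, ← Nat.choose_two_right] at hcard
  exact hcard

theorem IsPolarSpace.ncard_inf_eq_le [Finite F] [FiniteDimensional F V]
    (hS : IsPolarSpace e d S) (M : FormModel S)
    (hE : (Nat.card M.E : ℝ) * (Nat.card F : ℝ) ^ (finrank F V - 2 * d) ≤ (Nat.card F : ℝ) ^ e.eps)
    {U Z : Submodule F V} (hU : IsGenerator S U) {k : ℕ} (hk : finrank F Z + k = d) :
    ({W | IsGenerator S W ∧ W ⊓ U = Z}.ncard : ℝ) ≤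
      (Nat.card F : ℝ) ^ (e.eps * k + ((k.choose 2 : ℕ) : ℝ)) := by
  have hq : (0 : ℝ) < Nat.card F := by exact_mod_cast Nat.card_pos
  have h1 : ({W | IsGenerator S W ∧ W ⊓ U = Z}.ncard : ℝ) ≤
      (Nat.card F : ℝ) ^ ((finrank F V - 2 * d) * k) *
        ((Nat.card F : ℝ) ^ (k.choose 2) * (Nat.card M.E : ℝ) ^ k) := by
    exact_mod_cast hS.ncard_inf_eq_le_of_formModel M hU hk
  refine h1.trans ?_
  rw [Real.rpow_add hq, Real.rpow_natCast, Real.rpow_mul hq.le, Real.rpow_natCast]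
  calc _ = ((Nat.card M.E : ℝ) * (Nat.card F : ℝ) ^ (finrank F V - 2 * d)) ^ k *
        (Nat.card F : ℝ) ^ (k.choose 2) := by rw [mul_pow, ← pow_mul]; ring
    _ ≤ _ := by gcongr

end Opposite

/-! ### The residue of a totally singular subspace -/

section Residue

variable {F V : Type*} [Field F] [AddCommGroup V] [Module F V]
  {S : Set (Submodule F V)} {e : PolarType} {d : ℕ}

theorem sup_inf_eq_of_le {A P K T : Submodule F V} (hK : A ⊔ K = P) (hAT : A ≤ T) (hTP : T ≤ P) :
    A ⊔ T ⊓ K = T := by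
  rw [inf_comm, ← sup_inf_assoc_of_le K hAT, hK, inf_eq_right.2 hTP]

theorem finrank_add_of_le [FiniteDimensional F V] {A P K T : Submodule F V} (hK : A ⊔ K = P)
    (hAK : A ⊓ K = ⊥) (hAT : A ≤ T) (hTP : T ≤ P) :
    finrank F (T ⊓ K : Submodule F V) + finrank F A = finrank F T := by
  have h := Submodule.finrank_sup_add_finrank_inf_eq A (T ⊓ K)
  rw [sup_inf_eq_of_le hK hAT hTP, inf_left_comm, hAK, inf_bot_eq, finrank_bot] at h
  omega

theorem finrank_comap_of_injective {V' : Type*} [AddCommGroup V'] [Module F V']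
    {f : V' →ₗ[F] V} (hf : Function.Injective f) (T : Submodule F V) :
    finrank F (T.comap f) = finrank F (T ⊓ LinearMap.range f : Submodule F V) := by
  rw [(Submodule.equivMapOfInjective f hf _).finrank_eq, Submodule.map_comap_eq, inf_comm]

variable [FiniteDimensional F V]

/-- A complement `K` of a totally singular subspace `A` in `A^⊥` carries a polar space of the same
type, of rank `d - dim A`. -/
theorem IsPolarSpace.residue [Finite F] (hS : IsPolarSpace e d S) (M : FormModel S)
    (hM : M.IsHereditary e) {A K : Submodule F V} (hA : A ∈ S) (hK : A ⊔ K = M.perp A)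
    (hAK : A ⊓ K = ⊥) {m n : ℕ} (hm : finrank F A + m = d) (f : (Fin n → F) →ₗ[F] V)
    (hn : n = e.ambientDim m) (hf : Function.Injective f) (hfK : LinearMap.range f = K) :
    IsPolarSpace e m {W | W.map f ∈ S} := by
  have hKA : K ≤ M.perp A := hK ▸ le_sup_right
  have hfin : Finite V := Module.finite_of_finite F
  have hperp : ∀ v, v ∈ M.perp K → v ∈ K → ∃ a ∈ A, ∃ r ∈ M.perp ⊤, a + r = v := by
    intro v hv hvK
    have h1 : v ∈ M.perp (M.perp A) := by
      rw [← hK, FormModel.perp_sup]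
      exact ⟨hKA hvK, hv⟩
    exact Submodule.mem_sup.1 (FormModel.perp_perp_le hA h1)
  refine ⟨hM n f hf ?_ ?_, ⟨?_, ?_⟩, ?_⟩
  · intro v hv h
    have hvK : f v ∈ K := hfK ▸ ⟨v, rfl⟩
    have hv' : f v ∈ M.perp K := by
      rw [← hfK]
      rintro _ ⟨w, rfl⟩
      exact h w
    obtain ⟨a, ha, r, hr, har⟩ := hperp _ hv' hvK
    have hNa := ((M.mem A).1 hA).1 a ha
    have hr0 : r = 0 := by
      refine M.nondeg r ?_ fun w => hr w trivial
      have h2 : r = f v + (-1 : F) • a := by rw [← har]; simp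
      rw [h2]
      refine M.add _ _ hv (M.smul _ _ hNa) ?_
      rw [map_smul, M.refl _ _ (hKA hvK a ha), smul_zero]
    rw [hr0, add_zero] at har
    have h3 : f v ∈ A ⊓ K := ⟨har ▸ ha, hvK⟩
    rw [hAK, Submodule.mem_bot] at h3
    exact hf (h3.trans (map_zero f).symm)
  · rw [hfK]
    change finrank F (K ⊓ M.perp K : Submodule F V) ≤ finrank F (M.perp ⊤)
    have h1 : K ⊓ M.perp K ⊔ A ≤ A ⊔ M.perp ⊤ := by
      refine sup_le ?_ le_sup_left
      rintro v ⟨hv, hv'⟩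
      obtain ⟨a, ha, r, hr, rfl⟩ := hperp v hv' hv
      exact Submodule.add_mem_sup ha hr
    have h2 := Submodule.finrank_sup_add_finrank_inf_eq (K ⊓ M.perp K) A
    have h3 : K ⊓ M.perp K ⊓ A = ⊥ := by
      rw [eq_bot_iff, ← hAK]
      exact le_inf inf_le_right (inf_le_left.trans inf_le_left)
    rw [h3, finrank_bot] at h2
    have h4 := Submodule.finrank_mono h1
    have h5 := Submodule.finrank_add_le_finrank_add_finrank A (M.perp ⊤)
    omega
  · obtain ⟨U, hU, hAU⟩ := exists_le_isGenerator hA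
    refine ⟨U.comap f, M.mem_of_le hU.1 (Submodule.map_comap_le _ _), ?_⟩
    have h1 := finrank_add_of_le hK hAK hAU
      ((FormModel.le_perp_self hU.1).trans (FormModel.perp_anti hAU))
    have h2 := hS.finrank_eq M hU
    change finrank F (U.comap f) = m
    rw [finrank_comap_of_injective hf, hfK]
    omega
  · rintro _ ⟨W, hW, rfl⟩
    change finrank F W ≤ m
    have hWK : W.map f ≤ K := hfK ▸ LinearMap.map_le_range
    have h1 := hS.finrank_le (FormModel.sup_mem (M := M) hA hW (hWK.trans hKA))
    have h2 := Submodule.finrank_sup_add_finrank_inf_eq A (W.map f)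
    have h3 : A ⊓ W.map f = ⊥ := by
      rw [eq_bot_iff, ← hAK]
      exact inf_le_inf_left _ hWK
    rw [h3, finrank_bot, ← (Submodule.equivMapOfInjective f hf W).finrank_eq] at h2
    omega
  · rw [finrank_fin_fun, hn]

/-- The members of an EKR set that contain a fixed totally singular subspace `A` form an EKR set
in the residue of `A`. -/
theorem IsPolarSpace.ncard_le_maxEKR [Finite F] (hS : IsPolarSpace e d S) (M : FormModel S)
    (hM : M.IsHereditary e) {A : Submodule F V} (hA : A ∈ S) {m t : ℕ} (hm : finrank F A + m = d)
    {Y : Set (Submodule F V)} (hY : IsEKR S d t Y) :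
    {y ∈ Y | A ≤ y}.ncard ≤ maxEKR F e m t := by
  have hfin : Finite V := Module.finite_of_finite F
  obtain ⟨K, -, hAK, hK⟩ := exists_complement_within (FormModel.le_perp_self (M := M) hA)
  have hKA : K ≤ M.perp A := hK ▸ le_sup_right
  have hKn : finrank F K = e.ambientDim m := by
    have h1 := FormModel.finrank_perp_add (FormModel.inf_radical_eq_bot (M := M) hA)
    have h2 := Submodule.finrank_sup_add_finrank_inf_eq A K
    rw [hAK, hK, finrank_bot] at h2
    have h3 := hS.dim
    cases e <;> simp only [PolarType.ambientDim] at h3 ⊢ <;> omega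
  let g : (Fin (e.ambientDim m) → F) ≃ₗ[F] K :=
    LinearEquiv.ofFinrankEq _ _ (by rw [finrank_fin_fun, hKn])
  let f : (Fin (e.ambientDim m) → F) →ₗ[F] V := K.subtype ∘ₗ g
  have hf : Function.Injective f := K.injective_subtype.comp g.injective
  have hfK : LinearMap.range f = K := by
    rw [LinearMap.range_comp, LinearEquiv.range, Submodule.map_subtype_top]
  have hS' := hS.residue M hM hA hK hAK hm f rfl hf hfK
  have hperp : ∀ y, IsGenerator S y → A ≤ y → y ≤ M.perp A := fun y hy h =>
    (FormModel.le_perp_self hy.1).trans (FormModel.perp_anti h)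
  have hdim : ∀ T : Submodule F V, A ≤ T → T ≤ M.perp A →
      finrank F (T.comap f) + finrank F A = finrank F T := by
    intro T h1 h2
    rw [finrank_comap_of_injective hf, hfK, finrank_add_of_le hK hAK h1 h2]
  have hrec : ∀ T : Submodule F V, A ≤ T → T ≤ M.perp A → A ⊔ (T.comap f).map f = T := by
    intro T h1 h2
    rw [Submodule.map_comap_eq, hfK, inf_comm, sup_inf_eq_of_le hK h1 h2]
  have hinj : Set.InjOn (Submodule.comap f) {y ∈ Y | A ≤ y} := by
    rintro y₁ ⟨h1, h2⟩ y₂ ⟨h3, h4⟩ h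
    rw [← hrec y₁ h2 (hperp _ (hY.1 _ h1) h2), h, hrec y₂ h4 (hperp _ (hY.1 _ h3) h4)]
  have hEKR : IsEKR {W | W.map f ∈ S} m t (Submodule.comap f '' {y ∈ Y | A ≤ y}) := by
    refine ⟨?_, ?_⟩
    · rintro _ ⟨y, ⟨hy, hAy⟩, rfl⟩
      have hyG := hY.1 y hy
      refine ⟨M.mem_of_le hyG.1 (Submodule.map_comap_le _ _), fun W hW hle => ?_⟩
      have hWK : W.map f ≤ K := hfK ▸ LinearMap.map_le_range
      have h1 : A ⊔ W.map f ∈ S := FormModel.sup_mem (M := M) hA hW (hWK.trans hKA)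
      have h2 : y ≤ A ⊔ W.map f := by
        conv_lhs => rw [← hrec y hAy (hperp _ hyG hAy)]
        exact sup_le_sup_left (Submodule.map_mono hle) _
      exact Submodule.map_le_iff_le_comap.1 (le_sup_right.trans (hyG.2 h1 h2))
    · rintro _ ⟨y₁, ⟨h1, h2⟩, rfl⟩ _ ⟨y₂, ⟨h3, h4⟩, rfl⟩
      have h5 := hdim (y₁ ⊓ y₂) (le_inf h2 h4) (inf_le_left.trans (hperp _ (hY.1 _ h1) h2))
      have h6 := hY.2 y₁ h1 y₂ h3
      rw [← Submodule.comap_inf]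
      omega
  rw [← hinj.ncard_image]
  refine le_csSup ?_ ⟨_, _, hS', hEKR, rfl⟩
  refine ⟨Nat.card (Submodule F (Fin (e.ambientDim m) → F)), ?_⟩
  rintro _ ⟨S', Y', -, -, rfl⟩
  exact Set.ncard_le_card Y'

end Residue

/-! ### Counting subspaces of a vector space -/

section Gauss

variable {F V : Type*} [Field F] [Finite F] [AddCommGroup V] [Module F V] [FiniteDimensional F V]

/-- Every subspace of dimension `j` is spanned by as many independent `j`-tuples as `F ^ j`. -/
theorem card_finrank_eq_mul_le {j : ℕ} (hj : j ≤ finrank F V) :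
    Nat.card {T : Submodule F V // finrank F T = j} *
      ∏ i ∈ Finset.range j, (Nat.card F ^ j - Nat.card F ^ i) ≤
      ∏ i ∈ Finset.range j, (Nat.card F ^ finrank F V - Nat.card F ^ i) := by
  have hV : Finite V := Module.finite_of_finite F
  have := Fintype.ofFinite F
  let Φ : (Σ T : {T : Submodule F V // finrank F T = j},
      {s : Fin j → (T : Submodule F V) // LinearIndependent F s}) →
      {s : Fin j → V // LinearIndependent F s} :=
    fun p => ⟨fun i => p.2.1 i, p.2.2.map' p.1.1.subtype p.1.1.ker_subtype⟩
  have hspan : ∀ p, Submodule.span F (Set.range (Φ p).1) = p.1.1 := by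
    rintro ⟨⟨T, hT⟩, s, hs⟩
    refine Submodule.eq_of_le_of_finrank_le ?_ ?_
    · rw [Submodule.span_le]
      rintro _ ⟨i, rfl⟩
      exact (s i).2
    · rw [finrank_span_eq_card (Φ ⟨⟨T, hT⟩, s, hs⟩).2, Fintype.card_fin]
      exact hT.le
  have hΦ : Function.Injective Φ := by
    intro p p' h
    have h1 : p.1 = p'.1 := Subtype.ext (by rw [← hspan p, ← hspan p', h])
    obtain ⟨T, s, hs⟩ := p
    obtain ⟨T', s', hs'⟩ := p'
    obtain rfl : T = T' := h1
    have h2 : s = s' := by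
      funext i
      exact Subtype.ext (congrFun (congrArg Subtype.val h) i)
    subst h2
    rfl
  have h1 := Nat.card_le_card_of_injective Φ hΦ
  have h3 := Fintype.ofFinite {T : Submodule F V // finrank F T = j}
  rw [card_linearIndependent hj, Nat.card_sigma] at h1
  have h2 : ∀ T : {T : Submodule F V // finrank F T = j},
      Nat.card {s : Fin j → (T : Submodule F V) // LinearIndependent F s} =
        ∏ i ∈ Finset.range j, (Nat.card F ^ j - Nat.card F ^ i) := by
    rintro ⟨T, hT⟩
    rw [card_linearIndependent hT.ge, hT, ← Nat.card_eq_fintype_card,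
      Fin.prod_univ_eq_prod_range (fun i => Nat.card F ^ j - Nat.card F ^ i)]
  simp only [h2, Finset.sum_const, smul_eq_mul, Finset.card_univ, ← Nat.card_eq_fintype_card,
    Fin.prod_univ_eq_prod_range (fun i => Nat.card F ^ finrank F V - Nat.card F ^ i)] at h1
  exact h1

theorem gauss_natCast {q n j : ℕ} (hj : j ≤ n) :
    gauss q n j = (∏ i ∈ Finset.range j, ((q : ℝ) ^ (n - i) - 1)) /
      ∏ i ∈ Finset.range j, ((q : ℝ) ^ (j - i) - 1) := by
  have h1 : ∀ g : ℤ → ℝ, ∏ i ∈ Finset.Icc (1 : ℤ) j, g i = ∏ i ∈ Finset.range j, g (i + 1) := by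
    intro g
    refine Finset.prod_nbij' (fun z => (z - 1).toNat) (fun i => (i : ℤ) + 1) ?_ ?_ ?_ ?_ ?_
    · intro z hz; simp only [Finset.mem_Icc, Finset.mem_range] at hz ⊢; omega
    · intro i hi; simp only [Finset.mem_Icc, Finset.mem_range] at hi ⊢; omega
    · intro z hz; simp only [Finset.mem_Icc] at hz; omega
    · intro i hi; simp
    · intro z hz
      simp only [Finset.mem_Icc] at hz
      congr 1
      omega
  rw [gauss, if_pos ⟨by omega, by omega⟩, h1, Finset.prod_div_distrib]
  congr 1
  · refine Finset.prod_congr rfl fun i hi => ?_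
    rw [Finset.mem_range] at hi
    rw [show (n : ℤ) - ((i : ℤ) + 1) + 1 = ((n - i : ℕ) : ℤ) by omega, zpow_natCast]
  · rw [← Finset.prod_range_reflect]
    refine Finset.prod_congr rfl fun i hi => ?_
    rw [Finset.mem_range] at hi
    rw [show ((j - 1 - i : ℕ) : ℤ) + 1 = ((j - i : ℕ) : ℤ) by omega, zpow_natCast]

theorem card_finrank_eq_le_gauss {j : ℕ} (hj : j ≤ finrank F V) :
    (Nat.card {T : Submodule F V // finrank F T = j} : ℝ) ≤
      gauss (Nat.card F) (finrank F V) j := by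
  have hq : (1 : ℝ) < Nat.card F := by exact_mod_cast Finite.one_lt_card
  have hqn : 1 ≤ Nat.card F := Nat.card_pos
  have key : ∀ m, j ≤ m → ((∏ i ∈ Finset.range j, (Nat.card F ^ m - Nat.card F ^ i) : ℕ) : ℝ) =
      (∏ i ∈ Finset.range j, (Nat.card F : ℝ) ^ i) *
        ∏ i ∈ Finset.range j, ((Nat.card F : ℝ) ^ (m - i) - 1) := by
    intro m hm
    rw [← Finset.prod_mul_distrib, Nat.cast_prod]
    refine Finset.prod_congr rfl fun i hi => ?_
    rw [Finset.mem_range] at hi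
    rw [Nat.cast_sub (Nat.pow_le_pow_right hqn (by omega)), mul_sub, ← pow_add, mul_one,
      Nat.cast_pow, Nat.cast_pow, Nat.add_sub_cancel' (by omega)]
  have h1 : ((Nat.card {T : Submodule F V // finrank F T = j} *
      ∏ i ∈ Finset.range j, (Nat.card F ^ j - Nat.card F ^ i) : ℕ) : ℝ) ≤
      ((∏ i ∈ Finset.range j, (Nat.card F ^ finrank F V - Nat.card F ^ i) : ℕ) : ℝ) :=
    Nat.cast_le.2 (card_finrank_eq_mul_le hj)
  rw [Nat.cast_mul, key j le_rfl, key _ hj, mul_left_comm] at h1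
  have h2 : (0 : ℝ) < ∏ i ∈ Finset.range j, (Nat.card F : ℝ) ^ i :=
    Finset.prod_pos fun i _ => by positivity
  rw [gauss_natCast hj, le_div_iff₀]
  · exact le_of_mul_le_mul_left h1 h2
  · refine Finset.prod_pos fun i hi => ?_
    rw [Finset.mem_range] at hi
    exact sub_pos.2 (one_lt_pow₀ hq (by omega))

/-- By duality, the Gaussian coefficient also bounds the number of subspaces of codimension `j`. -/
theorem ncard_le_finrank_add_eq_le_gauss {j : ℕ} (X : Submodule F V) (hj : j ≤ finrank F X) :
    ({A : Submodule F V | A ≤ X ∧ finrank F A + j = finrank F X}.ncard : ℝ) ≤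
      gauss (Nat.card F) (finrank F X) j := by
  have hV : Finite V := Module.finite_of_finite F
  have hD : Finite (Dual F X) := Module.finite_of_finite F
  have h1 := card_finrank_eq_le_gauss (F := F) (V := Dual F X) (j := j)
    (by rwa [Subspace.dual_finrank_eq])
  rw [Subspace.dual_finrank_eq] at h1
  refine le_trans (Nat.cast_le.2 ?_) h1
  let Φ : {A : Submodule F V | A ≤ X ∧ finrank F A + j = finrank F X} →
      {T : Submodule F (Dual F X) // finrank F T = j} := fun A =>
    ⟨(A.1.comap X.subtype).dualAnnihilator, by
      have h2 := Subspace.finrank_add_finrank_dualAnnihilator_eq (A.1.comap X.subtype)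
      have h3 : finrank F (A.1.comap X.subtype) = finrank F A.1 :=
        (Submodule.comapSubtypeEquivOfLe A.2.1).finrank_eq
      have h4 := A.2.2
      omega⟩
  refine Nat.card_le_card_of_injective Φ ?_
  rintro ⟨A, hA, hA'⟩ ⟨A', hB, hB'⟩ h
  have h2 := Subspace.dualAnnihilator_inj.1 (congrArg Subtype.val h)
  have h3 := congrArg (Submodule.map X.subtype) h2
  rw [Submodule.map_comap_subtype, Submodule.map_comap_subtype] at h3
  exact Subtype.ext (by rwa [inf_eq_right.2 hA, inf_eq_right.2 hB] at h3)

end Gauss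

section Flags

variable {F V V' : Type*} [Field F] [AddCommGroup V] [Module F V]
  [AddCommGroup V'] [Module F V'] [FiniteDimensional F V] [FiniteDimensional F V']

theorem exists_linearEquiv_extend (h : finrank F V = finrank F V') {P : Submodule F V}
    {P' : Submodule F V'} (g : P ≃ₗ[F] P') : ∃ G : V ≃ₗ[F] V', ∀ p : P, G p = g p := by
  obtain ⟨C, hC⟩ := P.exists_isCompl
  obtain ⟨C', hC'⟩ := P'.exists_isCompl
  have h1 := Submodule.finrank_add_eq_of_isCompl hC
  have h2 := Submodule.finrank_add_eq_of_isCompl hC'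
  have h3 := g.finrank_eq
  let k : C ≃ₗ[F] C' := LinearEquiv.ofFinrankEq _ _ (by omega)
  refine ⟨(Submodule.prodEquivOfIsCompl P C hC).symm ≪≫ₗ (g.prodCongr k) ≪≫ₗ
    Submodule.prodEquivOfIsCompl P' C' hC', fun p => ?_⟩
  simp

theorem exists_linearEquiv_map_flag (h : finrank F V = finrank F V') {X Y : Submodule F V}
    {X' Y' : Submodule F V'} (hY : Y ≤ X) (hY' : Y' ≤ X') (h1 : finrank F X = finrank F X')
    (h2 : finrank F Y = finrank F Y') :
    ∃ G : V ≃ₗ[F] V', X.map (G : V →ₗ[F] V') = X' ∧ Y.map (G : V →ₗ[F] V') = Y' := by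
  have h3 := (Submodule.comapSubtypeEquivOfLe hY).finrank_eq
  have h4 := (Submodule.comapSubtypeEquivOfLe hY').finrank_eq
  let g₀ : Y.comap X.subtype ≃ₗ[F] Y'.comap X'.subtype :=
    LinearEquiv.ofFinrankEq _ _ (by omega)
  obtain ⟨g₁, hg₁⟩ := exists_linearEquiv_extend h1 g₀
  obtain ⟨G, hG⟩ := exists_linearEquiv_extend h g₁
  refine ⟨G, Submodule.eq_of_le_of_finrank_le ?_ ?_, Submodule.eq_of_le_of_finrank_le ?_ ?_⟩
  · rintro _ ⟨v, hv, rfl⟩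
    exact (hG ⟨v, hv⟩).symm ▸ Subtype.property _
  · rw [LinearEquiv.finrank_map_eq, h1]
  · rintro _ ⟨v, hv, rfl⟩
    have h5 := hG ⟨v, hY hv⟩
    rw [hg₁ ⟨⟨v, hY hv⟩, hv⟩] at h5
    exact h5.symm ▸ (g₀ ⟨⟨v, hY hv⟩, hv⟩).2
  · rw [LinearEquiv.finrank_map_eq, h2]

theorem finrank_coordSubspace {d m : ℕ} (hm : m ≤ d) : finrank F (coordSubspace F d m) = m := by
  have hmem : ∀ v : coordSubspace F d m, ∀ i : Fin d, m ≤ i → v.1 i = 0 := fun v i hi =>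
    v.2 i (by exact_mod_cast hi)
  let g : coordSubspace F d m ≃ₗ[F] (Fin m → F) :=
    { toFun := fun v i => v.1 (Fin.castLE hm i)
      map_add' := fun _ _ => rfl
      map_smul' := fun _ _ => rfl
      invFun := fun u => ⟨fun i => if h : (i : ℕ) < m then u ⟨i, h⟩ else 0, fun i hi =>
        dif_neg (by omega)⟩
      left_inv := fun v => by
        ext i
        by_cases h : (i : ℕ) < m
        · simp [h]
        · simp [h, hmem v i (by omega)]
      right_inv := fun u => by
        funext i
        simp }
  rw [g.finrank_eq, finrank_fin_fun]

theorem coordSubspace_mono {d : ℕ} {x y : ℤ} (h : y ≤ x) :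
    coordSubspace F d y ≤ coordSubspace F d x := fun _ hv i hi => hv i (h.trans hi)

theorem ncard_le_psi3 [Finite F] {d : ℕ} {U X Y : Submodule F V} (hU : finrank F U = d)
    (hXU : X ≤ U) (hYX : Y ≤ X) (z z₁ z₂ : ℤ) :
    {Z : Submodule F V | Z ≤ U ∧ (finrank F Z : ℤ) = z ∧
      (finrank F (Z ⊓ X : Submodule F V) : ℤ) = z₂ ∧
      (finrank F (Z ⊓ Y : Submodule F V) : ℤ) = z₁}.ncard ≤
      psi3 F d (finrank F X) (finrank F Y) z z₁ z₂ := by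
  have hXd : finrank F X ≤ d := hU ▸ Submodule.finrank_mono hXU
  have hYX' : finrank F Y ≤ finrank F X := Submodule.finrank_mono hYX
  have hYU := hYX.trans hXU
  have hfin : ∀ T ≤ U, finrank F (T.comap U.subtype) = finrank F T := fun T hT =>
    (Submodule.comapSubtypeEquivOfLe hT).finrank_eq
  obtain ⟨G, hGX, hGY⟩ := exists_linearEquiv_map_flag (V := U) (V' := Fin d → F)
    (by rw [finrank_fin_fun, hU]) (Submodule.comap_mono hYX)
    (coordSubspace_mono (F := F) (d := d)
      (by exact_mod_cast hYX' : (finrank F Y : ℤ) ≤ finrank F X))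
    (by rw [finrank_coordSubspace hXd, hfin X hXU])
    (by rw [finrank_coordSubspace (hYX'.trans hXd), hfin Y hYU])
  have hG : Function.Injective (G : U →ₗ[F] (Fin d → F)) := G.injective
  have hmap : ∀ T ≤ U, finrank F ((T.comap U.subtype).map (G : U →ₗ[F] (Fin d → F))) =
      finrank F T := fun T hT => by rw [LinearEquiv.finrank_map_eq, hfin T hT]
  rw [psi3, if_pos ⟨by omega, by exact_mod_cast hYX', by exact_mod_cast hXd⟩]
  refine Set.ncard_le_ncard_of_injOn
    (fun Z => (Z.comap U.subtype).map (G : U →ₗ[F] (Fin d → F))) ?_ ?_ (Set.toFinite _)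
  · rintro Z ⟨h1, h2, h3, h4⟩
    refine ⟨by rw [hmap Z h1, h2], ?_, ?_⟩
    · rw [← hGX, ← Submodule.map_inf _ hG, ← Submodule.comap_inf, hmap _ (inf_le_left.trans h1), h3]
    · rw [← hGY, ← Submodule.map_inf _ hG, ← Submodule.comap_inf, hmap _ (inf_le_left.trans h1), h4]
  · rintro Z ⟨h1, -⟩ Z' ⟨h1', -⟩ h
    have h2 := Submodule.map_injective_of_injective hG h
    have h3 := congrArg (Submodule.map U.subtype) h2
    rw [Submodule.map_comap_subtype, Submodule.map_comap_subtype] at h3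
    rwa [inf_eq_right.2 h1, inf_eq_right.2 h1'] at h3

end Flags

/-! ### Triples of generators -/

section Triples

variable {F V : Type*} [Field F] [AddCommGroup V] [Module F V]

theorem finrank_sup_inf_inf [FiniteDimensional F V] (a b c : Submodule F V) :
    finrank F (a ⊓ b ⊔ a ⊓ c ⊔ b ⊓ c : Submodule F V) +
      2 * finrank F (a ⊓ b ⊓ c : Submodule F V) =
      finrank F (a ⊓ b : Submodule F V) + finrank F (a ⊓ c : Submodule F V) +
        finrank F (b ⊓ c : Submodule F V) := by
  have h1 : (a ⊓ b) ⊓ (a ⊓ c) = a ⊓ b ⊓ c := by rw [← inf_inf_distrib_left, inf_assoc]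
  have h2 : (a ⊓ b ⊔ a ⊓ c) ⊓ (b ⊓ c) = a ⊓ b ⊓ c := by
    refine le_antisymm ?_ (le_inf (le_sup_of_le_left inf_le_left)
      (le_inf (inf_le_left.trans inf_le_right) inf_le_right))
    exact le_inf (le_inf (inf_le_left.trans (sup_le inf_le_left inf_le_left))
      (inf_le_right.trans inf_le_left)) (inf_le_right.trans inf_le_right)
  have h3 := Submodule.finrank_sup_add_finrank_inf_eq (a ⊓ b) (a ⊓ c)
  have h4 := Submodule.finrank_sup_add_finrank_inf_eq (a ⊓ b ⊔ a ⊓ c) (b ⊓ c)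
  rw [h1] at h3
  rw [h2] at h4
  omega

variable {S : Set (Submodule F V)} {e : PolarType} {d k : ℕ}

theorem FormModel.sup_inf_inf_mem (M : FormModel S) {a b c : Submodule F V} (ha : a ∈ S)
    (hb : b ∈ S) (hc : c ∈ S) : a ⊓ b ⊔ a ⊓ c ⊔ b ⊓ c ∈ S := by
  refine sup_mem (M := M) (sup_mem (M := M) (M.mem_of_le ha inf_le_left)
    (M.mem_of_le ha inf_le_left) ?_) (M.mem_of_le hb inf_le_left) ?_
  · exact inf_le_left.trans ((le_perp_self ha).trans (perp_anti inf_le_left))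
  · rw [perp_sup]
    exact le_inf (inf_le_left.trans ((le_perp_self hb).trans (perp_anti inf_le_right)))
      (inf_le_right.trans ((le_perp_self hc).trans (perp_anti inf_le_right)))

variable [FiniteDimensional F V]

theorem IsPolarSpace.finrank_add_finrank_add_finrank_le (hS : IsPolarSpace e d S)
    (M : FormModel S) {a b c : Submodule F V} (ha : a ∈ S) (hb : b ∈ S) (hc : c ∈ S) :
    finrank F (a ⊓ b : Submodule F V) + finrank F (a ⊓ c : Submodule F V) +
      finrank F (b ⊓ c : Submodule F V) ≤ d + 2 * finrank F (a ⊓ b ⊓ c : Submodule F V) := by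
  rw [← finrank_sup_inf_inf]
  exact Nat.add_le_add_right (hS.finrank_le (M.sup_inf_inf_mem ha hb hc)) _

omit [FiniteDimensional F V] in
theorem IsEKR.le_finrank_inf {Y : Set (Submodule F V)} (hY : IsEKR S d (2 * k) Y)
    {a b : Submodule F V} (ha : a ∈ Y) (hb : b ∈ Y) :
    d ≤ finrank F (a ⊓ b : Submodule F V) + 2 * k := by
  have := hY.2 a ha b hb
  omega

theorem IsEKR.le_finrank_inf_inf (hS : IsPolarSpace e d S) (M : FormModel S)
    {Y : Set (Submodule F V)} (hY : IsEKR S d (2 * k) Y) {a b c : Submodule F V} (ha : a ∈ Y)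
    (hb : b ∈ Y) (hc : c ∈ Y) : d ≤ finrank F (a ⊓ b ⊓ c : Submodule F V) + 3 * k := by
  have h1 := hS.finrank_add_finrank_add_finrank_le M (hY.1 a ha).1 (hY.1 b hb).1 (hY.1 c hc).1
  have h2 := hY.le_finrank_inf ha hb
  have h3 := hY.le_finrank_inf ha hc
  have h4 := hY.le_finrank_inf hb hc
  omega

/-- A maximal EKR set inside a ball of radius `k` is the whole ball. -/
theorem IsMaximalEKR.eq_ball (hS : IsPolarSpace e d S) (M : FormModel S)
    {Y : Set (Submodule F V)} (hY : IsMaximalEKR S d (2 * k) Y) {U : Submodule F V}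
    (hU : IsGenerator S U) (h : ∀ y ∈ Y, d ≤ finrank F (y ⊓ U : Submodule F V) + k) :
    Y = {W | IsGenerator S W ∧ d ≤ finrank F (W ⊓ U : Submodule F V) + k} := by
  have h1 : Y ⊆ {W | IsGenerator S W ∧ d ≤ finrank F (W ⊓ U : Submodule F V) + k} :=
    fun y hy => ⟨hY.1.1 y hy, h y hy⟩
  refine h1.antisymm (hY.2 ⟨fun W hW => hW.1, ?_⟩ h1)
  rintro W₁ ⟨-, hW₁⟩ W₂ ⟨-, hW₂⟩
  have h2 := Submodule.finrank_sup_add_finrank_inf_eq (W₁ ⊓ U) (W₂ ⊓ U)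
  have h3 : finrank F (W₁ ⊓ U ⊔ W₂ ⊓ U : Submodule F V) ≤ finrank F U :=
    Submodule.finrank_mono (sup_le inf_le_right inf_le_right)
  have h4 : finrank F (W₁ ⊓ U ⊓ (W₂ ⊓ U) : Submodule F V) ≤
      finrank F (W₁ ⊓ W₂ : Submodule F V) :=
    Submodule.finrank_mono (inf_le_inf inf_le_left inf_le_left)
  have h5 := hS.finrank_eq M hU
  omega

theorem IsMaximalEKR.nonempty [Finite V] {t : ℕ} (hS : IsPolarSpace e d S) (M : FormModel S)
    {Y : Set (Submodule F V)} (hY : IsMaximalEKR S d t Y) : Y.Nonempty := by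
  obtain ⟨W, hW, -⟩ := hS.rank.1
  obtain ⟨U, hU, -⟩ := exists_le_isGenerator hW
  by_contra h
  rw [Set.not_nonempty_iff_eq_empty] at h
  have h1 : IsEKR S d t {U} := by
    refine ⟨fun W hW => ?_, fun W hW W' hW' => ?_⟩
    · rw [Set.mem_singleton_iff.1 hW]; exact hU
    · rw [Set.mem_singleton_iff.1 hW, Set.mem_singleton_iff.1 hW', inf_idem, hS.finrank_eq M hU]
      omega
  have h2 := hY.2 h1 (by rw [h]; exact Set.empty_subset _)
  rw [h] at h2
  exact h2 (Set.mem_singleton U)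

end Triples

/-! ### The two counting bounds -/

section Bounds

theorem ncard_le_mul_of_subset_biUnion {α ι : Type*} [Finite α] [Finite ι] {T : Set α}
    (P : Set ι) (f : ι → Set α) (h : T ⊆ ⋃ p ∈ P, f p) {c : ℝ}
    (hc : ∀ p ∈ P, ((f p).ncard : ℝ) ≤ c) : (T.ncard : ℝ) ≤ P.ncard * c := by
  have h1 : (T.ncard : ℝ) ≤ ∑ p ∈ (Set.toFinite P).toFinset, ((f p).ncard : ℝ) := by
    exact_mod_cast (Set.ncard_le_ncard (by simpa using h) (Set.toFinite _)).trans
      ((Set.toFinite P).toFinset.set_ncard_biUnion_le f)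
  refine h1.trans ((Finset.sum_le_card_nsmul _ _ c fun p hp => hc p (by simpa using hp)).trans_eq ?_)
  rw [nsmul_eq_mul, Set.ncard_eq_toFinset_card P]

variable {F V : Type*} [Field F] [Finite F] [AddCommGroup V] [Module F V] [FiniteDimensional F V]
  {S : Set (Submodule F V)} {e : PolarType} {d k : ℕ}

/-- The members of `Y` meeting a `(d - 3k)`-subspace `X` in dimension greater than `d - 4k` all
contain one of the `(d - 4k + 1)`-subspaces of `X`. -/
theorem IsEKR.ncard_le_b1Even (hS : IsPolarSpace e d S) (M : FormModel S)
    (hM : M.IsHereditary e) (hk : 1 ≤ k) (hd : 4 * k ≤ d) {Y : Set (Submodule F V)}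
    (hY : IsEKR S d (2 * k) Y) {X : Submodule F V} (hX : X ∈ S) (hXd : finrank F X + 3 * k = d) :
    ({y ∈ Y | d + 1 ≤ finrank F (y ⊓ X : Submodule F V) + 4 * k}.ncard : ℝ) ≤
      b1Even F e d (2 * k) := by
  have hV : Finite V := Module.finite_of_finite F
  have h1 := ncard_le_mul_of_subset_biUnion
    (T := {y ∈ Y | d + 1 ≤ finrank F (y ⊓ X : Submodule F V) + 4 * k})
    {A : Submodule F V | A ≤ X ∧ finrank F A + (k - 1) = finrank F X}
    (fun A => {y ∈ Y | A ≤ y}) (c := maxEKR F e (2 * (2 * k) - 1) (2 * k)) ?_ ?_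
  · refine h1.trans ?_
    have h2 := ncard_le_finrank_add_eq_le_gauss X (j := k - 1) (by omega)
    have h3 : (d : ℤ) - 3 * ((2 * k : ℕ) : ℤ) / 2 = finrank F X := by omega
    have h4 : ((2 * k : ℕ) : ℤ) / 2 - 1 = ((k - 1 : ℕ) : ℤ) := by omega
    rw [b1Even, h3, h4]
    exact mul_le_mul_of_nonneg_right h2 (Nat.cast_nonneg _)
  · rintro y ⟨hy, hyX⟩
    obtain ⟨A, hA, hA'⟩ := exists_submodule_finrank_eq (F := F) (W := y ⊓ X) (m := d + 1 - 4 * k)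
      (by omega)
    simp only [Set.mem_iUnion]
    exact ⟨A, ⟨hA.trans inf_le_right, by omega⟩, hy, hA.trans inf_le_left⟩
  · rintro A ⟨hA, hA'⟩
    exact Nat.cast_le.2 (hS.ncard_le_maxEKR M hM (M.mem_of_le hX hA) (by omega) hY)

/-- The generators `y` in question are classified by `y ∩ U`, which the function `ψ₃` counts by the
dimension of its intersection with `X'`. -/
theorem IsPolarSpace.ncard_le_b2Even (hS : IsPolarSpace e d S) (M : FormModel S)
    (hE : (Nat.card M.E : ℝ) * (Nat.card F : ℝ) ^ (finrank F V - 2 * d) ≤ (Nat.card F : ℝ) ^ e.eps)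
    {U X X' : Submodule F V} (hU : IsGenerator S U) (hXU : X ≤ U)
    (hX' : X' ≤ X) (hXd : finrank F X + 3 * k = d) (hXd' : finrank F X' + 4 * k = d + 1)
    {T : Set (Submodule F V)} (hT : ∀ y ∈ T, IsGenerator S y ∧
      finrank F (y ⊓ U : Submodule F V) + k = d ∧ finrank F (y ⊓ X : Submodule F V) + 4 * k = d ∧
      d + 2 ≤ finrank F (y ⊓ X' : Submodule F V) + 5 * k) :
    (T.ncard : ℝ) ≤ b2Even F e d (2 * k) := by
  have hV : Finite V := Module.finite_of_finite F
  let P : ℤ → Set (Submodule F V) := fun i => {Z | Z ≤ U ∧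
    (finrank F Z : ℤ) = (d : ℤ) - ((2 * k : ℕ) : ℤ) / 2 ∧
    (finrank F (Z ⊓ X : Submodule F V) : ℤ) = (d : ℤ) - 2 * ((2 * k : ℕ) : ℤ) ∧
    (finrank F (Z ⊓ X' : Submodule F V) : ℤ) = (d : ℤ) - 5 * ((2 * k : ℕ) : ℤ) / 2 + 1 + i}
  let I : Finset ℤ := Finset.Icc (1 : ℤ) (((2 * k : ℕ) : ℤ) / 2 - 1)
  have h1 : (⋃ i ∈ I, P i).ncard ≤ psiEven F d (2 * k) := by
    refine (I.set_ncard_biUnion_le P).trans (Finset.sum_le_sum fun i _ => ?_)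
    have h2 : (d : ℤ) - 3 * ((2 * k : ℕ) : ℤ) / 2 = finrank F X := by omega
    have h3 : (d : ℤ) - 2 * ((2 * k : ℕ) : ℤ) + 1 = finrank F X' := by omega
    rw [h2, h3]
    exact ncard_le_psi3 (hS.finrank_eq M hU) hXU hX' _ _ _
  have h2 := ncard_le_mul_of_subset_biUnion (T := T) (⋃ i ∈ I, P i)
    (fun Z => {W | IsGenerator S W ∧ W ⊓ U = Z})
    (c := (Nat.card F : ℝ) ^ (e.eps * k + ((k.choose 2 : ℕ) : ℝ))) ?_ ?_
  · refine h2.trans ?_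
    have h3 : (((2 * k : ℕ) : ℝ) / 2) = k := by push_cast; ring
    rw [b2Even, h3, Nat.mul_div_cancel_left k two_pos, mul_comm]
    exact mul_le_mul_of_nonneg_left (Nat.cast_le.2 h1) (by positivity)
  · intro y hy
    obtain ⟨h3, h4, h5, h6⟩ := hT y hy
    have h7 : y ⊓ U ⊓ X = y ⊓ X := by rw [inf_assoc, inf_eq_right.2 hXU]
    have h8 : y ⊓ U ⊓ X' = y ⊓ X' := by rw [inf_assoc, inf_eq_right.2 (hX'.trans hXU)]
    have h9 : finrank F (y ⊓ X' : Submodule F V) ≤ finrank F (y ⊓ X : Submodule F V) :=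
      Submodule.finrank_mono (inf_le_inf_left _ hX')
    simp only [Set.mem_iUnion]
    refine ⟨y ⊓ U, ⟨(finrank F (y ⊓ X' : Submodule F V) : ℤ) - (d - 5 * k + 1), ?_, ?_⟩, h3, rfl⟩
    · rw [Finset.mem_Icc]
      omega
    · refine ⟨inf_le_right, by omega, ?_, ?_⟩
      · rw [h7]; omega
      · rw [h8]; omega
  · intro Z hZ
    simp only [Set.mem_iUnion] at hZ
    obtain ⟨i, -, -, h3, -⟩ := hZ
    exact hS.ncard_inf_eq_le M hE hU (by omega)

end Bounds

/-! ### Large maximal EKR sets -/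

section Classification

variable {F V : Type*} [Field F] [Finite F] [AddCommGroup V] [Module F V] [FiniteDimensional F V]
  {S : Set (Submodule F V)} {e : PolarType} {d k : ℕ}

/-- If no triple meets in the smallest possible dimension `d - 3k`, then `Y` is small: all
members meet a `(d - 3k)`-subspace of a smallest pairwise intersection in dimension greater than
`d - 4k`. -/
theorem IsEKR.ncard_le_b1Even_of_triples (hS : IsPolarSpace e d S) (M : FormModel S)
    (hM : M.IsHereditary e) (hk : 1 ≤ k) (hd : 4 * k ≤ d) {Y : Set (Submodule F V)}
    (hY : IsEKR S d (2 * k) Y) (hne : Y.Nonempty)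
    (h : ∀ a ∈ Y, ∀ b ∈ Y, ∀ c ∈ Y, d < finrank F (a ⊓ b ⊓ c : Submodule F V) + 3 * k) :
    (Y.ncard : ℝ) ≤ b1Even F e d (2 * k) := by
  have hV : Finite V := Module.finite_of_finite F
  obtain ⟨⟨y₁, y₂⟩, ⟨hy₁, hy₂⟩, hmin⟩ := Set.exists_min_image (Y ×ˢ Y)
    (fun p => finrank F (p.1 ⊓ p.2 : Submodule F V)) (Set.toFinite _) (hne.prod hne)
  dsimp only at hy₁ hy₂ hmin
  have hp := hY.le_finrank_inf hy₁ hy₂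
  obtain ⟨X, hX, hXd⟩ := exists_submodule_finrank_eq (F := F) (W := y₁ ⊓ y₂) (m := d - 3 * k)
    (by omega)
  have hXS : X ∈ S := M.mem_of_le (hY.1 _ hy₁).1 (hX.trans inf_le_left)
  refine le_trans (Nat.cast_le.2 (Set.ncard_le_ncard ?_ (Set.toFinite _)))
    (hY.ncard_le_b1Even hS M hM hk hd hXS (by omega))
  intro y hy
  refine ⟨hy, ?_⟩
  have h1 := hS.finrank_add_finrank_add_finrank_le M (hY.1 _ hy₁).1 (hY.1 _ hy₂).1 (hY.1 _ hy).1
  have h2 := hmin (y₁, y) ⟨hy₁, hy⟩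
  have h3 := hmin (y₂, y) ⟨hy₂, hy⟩
  have h4 := h _ hy₁ _ hy₂ _ hy
  have h5 := Submodule.finrank_sup_add_finrank_inf_eq (y₁ ⊓ y₂ ⊓ y) X
  have h6 : finrank F (y₁ ⊓ y₂ ⊓ y ⊔ X : Submodule F V) ≤
      finrank F (y₁ ⊓ y₂ : Submodule F V) :=
    Submodule.finrank_mono (sup_le inf_le_left hX)
  have h7 : finrank F (y₁ ⊓ y₂ ⊓ y ⊓ X : Submodule F V) ≤ finrank F (y ⊓ X : Submodule F V) :=
    Submodule.finrank_mono (inf_le_inf_right _ inf_le_right)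
  dsimp only at h2 h3
  omega

/-- Three members of `Y` that meet in a subspace `X` of the smallest possible dimension `d - 3k`
have pairwise intersections spanning a generator `U`. A member of `Y` meeting `X` in dimension at
most `d - 4k` is at distance `k` from `U`; the others are counted by the first bound. Once some
member of `Y` lies outside the ball about `U`, the former are counted by the second bound. -/
theorem IsMaximalEKR.exists_eq_ball_of_triple (hS : IsPolarSpace e d S) (M : FormModel S)
    (hM : M.IsHereditary e)
    (hE : (Nat.card M.E : ℝ) * (Nat.card F : ℝ) ^ (finrank F V - 2 * d) ≤ (Nat.card F : ℝ) ^ e.eps)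
    (hk : 1 ≤ k) (hd : 4 * k ≤ d) {Y : Set (Submodule F V)} (hY : IsMaximalEKR S d (2 * k) Y)
    (hcard : b1Even F e d (2 * k) + b2Even F e d (2 * k) < (Y.ncard : ℝ))
    {y₁ y₂ y₃ : Submodule F V} (hy₁ : y₁ ∈ Y) (hy₂ : y₂ ∈ Y) (hy₃ : y₃ ∈ Y)
    (h : finrank F (y₁ ⊓ y₂ ⊓ y₃ : Submodule F V) + 3 * k = d) :
    ∃ U, IsGenerator S U ∧
      Y = {W | IsGenerator S W ∧ d ≤ finrank F (W ⊓ U : Submodule F V) + k} := by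
  have hV : Finite V := Module.finite_of_finite F
  have hYE := hY.1
  have hgen := hYE.1
  set X := y₁ ⊓ y₂ ⊓ y₃ with hX
  set U := y₁ ⊓ y₂ ⊔ y₁ ⊓ y₃ ⊔ y₂ ⊓ y₃ with hUdef
  have hXU : X ≤ U := le_sup_of_le_left (le_sup_of_le_left inf_le_left)
  have hUS : U ∈ S := M.sup_inf_inf_mem (hgen _ hy₁).1 (hgen _ hy₂).1 (hgen _ hy₃).1
  have hU : IsGenerator S U := by
    refine hS.isGenerator hUS ?_
    have h1 : finrank F U + 2 * finrank F X = _ := finrank_sup_inf_inf y₁ y₂ y₃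
    have h2 := hYE.le_finrank_inf hy₁ hy₂
    have h3 := hYE.le_finrank_inf hy₁ hy₃
    have h4 := hYE.le_finrank_inf hy₂ hy₃
    omega
  have hUd := hS.finrank_eq M hU
  refine ⟨U, hU, ?_⟩
  by_cases hball : ∀ y ∈ Y, d ≤ finrank F (y ⊓ U : Submodule F V) + k
  · exact hY.eq_ball hS M hU hball
  push Not at hball
  obtain ⟨y₄, hy₄, hy₄U⟩ := hball
  exfalso
  have hsmall : ∀ y ∈ Y, finrank F (y ⊓ X : Submodule F V) + 4 * k ≤ d →
      finrank F (y ⊓ U : Submodule F V) + k = d ∧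
        finrank F (y ⊓ X : Submodule F V) + 4 * k = d := by
    intro y hy hyX
    have h1 := finrank_sup_inf_inf (y ⊓ y₁) (y ⊓ y₂) (y ⊓ y₃)
    rw [← inf_inf_distrib_left, ← inf_inf_distrib_left, ← inf_inf_distrib_left,
      ← inf_inf_distrib_left, ← hX] at h1
    have h2 : finrank F (y ⊓ (y₁ ⊓ y₂) ⊔ y ⊓ (y₁ ⊓ y₃) ⊔ y ⊓ (y₂ ⊓ y₃) : Submodule F V) ≤
        finrank F (y ⊓ U : Submodule F V) := by
      refine Submodule.finrank_mono (sup_le (sup_le ?_ ?_) ?_)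
      · exact inf_le_inf_left _ (le_sup_of_le_left le_sup_left)
      · exact inf_le_inf_left _ (le_sup_of_le_left le_sup_right)
      · exact inf_le_inf_left _ le_sup_right
    have h3 := hYE.le_finrank_inf_inf hS M hy hy₁ hy₂
    have h4 := hYE.le_finrank_inf_inf hS M hy hy₁ hy₃
    have h5 := hYE.le_finrank_inf_inf hS M hy hy₂ hy₃
    rw [inf_assoc] at h3 h4 h5
    have h6 := Submodule.finrank_sup_add_finrank_inf_eq (y ⊓ U) X
    rw [inf_assoc, inf_eq_right.2 hXU] at h6
    have h7 : finrank F (y ⊓ U ⊔ X : Submodule F V) ≤ finrank F U :=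
      Submodule.finrank_mono (sup_le inf_le_right hXU)
    omega
  have hy₄X : d + 1 ≤ finrank F (y₄ ⊓ X : Submodule F V) + 4 * k := by
    by_contra hlt
    have := hsmall y₄ hy₄ (by omega)
    omega
  obtain ⟨X', hX', hXd'⟩ := exists_submodule_finrank_eq (F := F) (W := y₄ ⊓ X)
    (m := d + 1 - 4 * k) (by omega)
  have hX'X : X' ≤ X := hX'.trans inf_le_right
  have hlarge : ∀ y ∈ Y, finrank F (y ⊓ X : Submodule F V) + 4 * k ≤ d →
      d + 2 ≤ finrank F (y ⊓ X' : Submodule F V) + 5 * k := by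
    intro y hy hyX
    obtain ⟨h1, -⟩ := hsmall y hy hyX
    by_contra hlt
    -- Otherwise `U` is spanned by `y ∩ U` and `X' ≤ y₄`, so `y ∩ y₄` is perpendicular to `U`.
    have h2 := Submodule.finrank_sup_add_finrank_inf_eq (y ⊓ U) X'
    rw [inf_assoc, inf_eq_right.2 (hX'X.trans hXU)] at h2
    have h3 : y ⊓ U ⊔ X' = U := Submodule.eq_of_le_of_finrank_le
      (sup_le inf_le_right (hX'X.trans hXU)) (by omega)
    have h4 : y ⊓ y₄ ≤ M.perp U := by
      rw [← h3, FormModel.perp_sup]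
      refine le_inf ?_ ?_
      · exact inf_le_left.trans ((FormModel.le_perp_self (hgen y hy).1).trans
          (FormModel.perp_anti inf_le_left))
      · exact inf_le_right.trans ((FormModel.le_perp_self (hgen _ hy₄).1).trans
          (FormModel.perp_anti (hX'.trans inf_le_left)))
    have h5 : y ⊓ y₄ ≤ U :=
      FormModel.le_of_le_perp hU (M.mem_of_le (hgen y hy).1 inf_le_left) h4
    have h6 : finrank F (y ⊓ y₄ : Submodule F V) ≤
        finrank F ((y ⊓ U) ⊓ (y₄ ⊓ U) : Submodule F V) :=
      Submodule.finrank_mono (le_inf (le_inf inf_le_left h5) (le_inf inf_le_right h5))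
    have h7 := Submodule.finrank_sup_add_finrank_inf_eq (y ⊓ U) (y₄ ⊓ U)
    have h8 : finrank F U ≤ finrank F (y ⊓ U ⊔ y₄ ⊓ U : Submodule F V) := by
      conv_lhs => rw [← h3]
      exact Submodule.finrank_mono (sup_le_sup_left
        (le_inf (hX'.trans inf_le_left) (hX'X.trans hXU)) _)
    have h9 := hYE.le_finrank_inf hy hy₄
    omega
  have hb1 := hYE.ncard_le_b1Even hS M hM hk hd (M.mem_of_le hUS hXU) h
  have hb2 := hS.ncard_le_b2Even M hE hU hXU hX'X h (by omega)
    (T := {y ∈ Y | finrank F (y ⊓ X : Submodule F V) + 4 * k ≤ d})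
    fun y hy => ⟨hgen y hy.1, (hsmall y hy.1 hy.2).1, (hsmall y hy.1 hy.2).2, hlarge y hy.1 hy.2⟩
  have hunion : Y ⊆ {y ∈ Y | d + 1 ≤ finrank F (y ⊓ X : Submodule F V) + 4 * k} ∪
      {y ∈ Y | finrank F (y ⊓ X : Submodule F V) + 4 * k ≤ d} := by
    intro y hy
    rcases Nat.lt_or_ge d (finrank F (y ⊓ X : Submodule F V) + 4 * k) with hlt | hge
    exacts [Or.inl ⟨hy, hlt⟩, Or.inr ⟨hy, hge⟩]
  have hle := (Set.ncard_le_ncard hunion (Set.toFinite _)).trans (Set.ncard_union_le _ _)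
  have hle' : (Y.ncard : ℝ) ≤ _ := Nat.cast_le.2 hle
  rw [Nat.cast_add] at hle'
  linarith

end Classification

end PolarEKR

theorem mainTheorem2 {F V : Type*} [Field F] [Finite F] [AddCommGroup V] [Module F V]
    [FiniteDimensional F V] (e : PolarEKR.PolarType) (d t : ℕ) (ht : Even t) (hd : 2 * t ≤ d)
    (S : Set (Submodule F V)) (hS : PolarEKR.IsPolarSpace e d S)
    (Y : Set (Submodule F V)) (hY : PolarEKR.IsMaximalEKR S d t Y)
    (hcard : PolarEKR.b1Even F e d t + PolarEKR.b2Even F e d t < (Y.ncard : ℝ)) :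
    ∃ U : Submodule F V, PolarEKR.IsGenerator S U ∧
      Y = {W | PolarEKR.IsGenerator S W ∧
        (d : ℤ) - (t : ℤ) / 2 ≤ Module.finrank F (W ⊓ U : Submodule F V)} := by
  have hV : Finite V := Module.finite_of_finite F
  obtain ⟨M, hM, hE⟩ := hS.exists_formModel
  obtain ⟨k, rfl⟩ := ht.exists_two_nsmul
  rw [smul_eq_mul] at *
  have hne := hY.nonempty hS M
  suffices h : ∃ U, PolarEKR.IsGenerator S U ∧ Y = {W | PolarEKR.IsGenerator S W ∧
      d ≤ Module.finrank F (W ⊓ U : Submodule F V) + k} by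
    obtain ⟨U, hU, hYU⟩ := h
    refine ⟨U, hU, hYU.trans (Set.ext fun W => and_congr_right fun _ => ?_)⟩
    omega
  rcases Nat.eq_zero_or_pos k with rfl | hk
  · obtain ⟨U, hU⟩ := hne
    exact ⟨U, hY.1.1 U hU, hY.eq_ball hS M (hY.1.1 U hU) fun y hy => hY.1.le_finrank_inf hy hU⟩
  by_cases htriple : ∃ a ∈ Y, ∃ b ∈ Y, ∃ c ∈ Y,
      Module.finrank F (a ⊓ b ⊓ c : Submodule F V) + 3 * k = d
  · obtain ⟨a, ha, b, hb, c, hc, h⟩ := htriple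
    exact hY.exists_eq_ball_of_triple hS M hM hE hk (by omega) hcard ha hb hc h
  · exfalso
    push Not at htriple
    have h1 := hY.1.ncard_le_b1Even_of_triples hS M hM hk (by omega) hne fun a ha b hb c hc =>
      lt_of_le_of_ne (hY.1.le_finrank_inf_inf hS M ha hb hc) (htriple a ha b hb c hc).symm
    have h2 : (0 : ℝ) ≤ PolarEKR.b2Even F e d (2 * k) := by
      unfold PolarEKR.b2Even
      positivity
    linarith
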